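/- An instance of \textsc{min bp sm forbidden} is $\mathcal I=(G,O,P)$, where $G=(U\cup W,E)$ is a finite bipartite graph with $n$ vertices and $m$ edges, $O$ assigns to each vertex a strictly ordered preference list of its neighbours, and $P\subseteq E$ is a set of $L=|P|$ forbidden edges. An edge $uw\in E\setminus M$ blocks a matching $M$ if each of $u$ and $w$ is unmatched in $M$ or prefers the other to its partner in $M$; $bp(M)$ is the set of edges that block $M$. The task is to find a matching $M$ with $M\cap P=\emptyset$ such that $|bp(M)|\le|bp(M')|$ for every matching $M'$ of $G$ with $M'\cap P=\emptyset$. Theorem. \textsc{min bp sm forbidden} can be solved in $O(n^2m^{L})$ time, where $L=|P|$, and hence in polynomial time for every fixed value of $L$. More precisely, there are a program for a unit-cost random access machine (with addition, subtraction, comparison and indirect addressing, on words of $O(\log n)$ bits) and a constant $C$ such that, given any instance $\mathcal I$ as the sequence of its preference lists and its forbidden edges, the program halts after at most $C\,(n^2m^{L}+1)$ steps and outputs a solution of $\mathcal I$; and for every $L$ there is a polynomial $q$ such that on all instances with $|P|=L$ it halts and outputs a solution after at most $q(N)$ steps, where $N$ is the length of the input. -/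

import Mathlib

/-! ### Stable marriage instances with forbidden edges -/

/-- A stable marriage instance (a bipartite graph with colour classes `Fin men` and `Fin women`,
together with strictly ordered, not necessarily complete preference lists over the neighbours of
each vertex) and a set of forbidden edges. The graph is the one on which man `u` and woman `w`
are adjacent iff they occur on each other's lists; lists are in order of decreasing preference. -/
structure SMInstance where
  men : ℕ
  women : ℕ
  manList : Fin men → List (Fin women)
  womanList : Fin women → List (Fin men)
  manList_nodup : ∀ u, (manList u).Nodup
  womanList_nodup : ∀ w, (womanList w).Nodup
  mutual_acceptable : ∀ u w, w ∈ manList u ↔ u ∈ womanList w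
  forbidden : List (Fin men × Fin women)
  forbidden_nodup : forbidden.Nodup
  forbidden_edge : ∀ e ∈ forbidden, e.2 ∈ manList e.1

namespace SMInstance

variable (I : SMInstance)

/-- The type of man-woman pairs. -/
abbrev Pair : Type := Fin I.men × Fin I.women

/-- The edge set `E` of the underlying bipartite graph. -/
def edges : Finset I.Pair := Finset.univ.filter fun e => e.2 ∈ I.manList e.1

/-- The number `n` of vertices. -/
def numVertices : ℕ := I.men + I.women

/-- The number `m` of edges. -/
def numEdges : ℕ := I.edges.card

/-- The set `P` of forbidden edges. -/
def forbiddenSet : Finset I.Pair := I.forbidden.toFinset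

/-- Man `u` strictly prefers `w` to `w'`. -/
def ManPrefers (u : Fin I.men) (w w' : Fin I.women) : Prop :=
  (I.manList u).idxOf w < (I.manList u).idxOf w'

/-- Woman `w` strictly prefers `u` to `u'`. -/
def WomanPrefers (w : Fin I.women) (u u' : Fin I.men) : Prop :=
  (I.womanList w).idxOf u < (I.womanList w).idxOf u'

/-- `M` is a matching: a set of pairwise vertex-disjoint edges. -/
structure IsMatching (M : Finset I.Pair) : Prop where
  subset_edges : M ⊆ I.edges
  man_unique : ∀ e ∈ M, ∀ f ∈ M, e.1 = f.1 → e = f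
  woman_unique : ∀ e ∈ M, ∀ f ∈ M, e.2 = f.2 → e = f

/-- The edge `e` blocks `M`: it is not in `M`, and each endpoint is unmatched in `M` or prefers
the other endpoint to its partner in `M`. -/
def Blocks (M : Finset I.Pair) (e : I.Pair) : Prop :=
  e ∈ I.edges ∧ e ∉ M ∧
    (∀ w', (e.1, w') ∈ M → I.ManPrefers e.1 e.2 w') ∧
    (∀ u', (u', e.2) ∈ M → I.WomanPrefers e.2 e.1 u')

open Classical in
/-- The set `bp(M)` of blocking edges. -/
noncomputable def bp (M : Finset I.Pair) : Finset I.Pair :=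
  Finset.univ.filter fun e => I.Blocks M e

/-- `M` is a matching that contains no forbidden edge. -/
def Feasible (M : Finset I.Pair) : Prop := I.IsMatching M ∧ Disjoint M I.forbiddenSet

/-- `M` is a solution of the minimisation problem: it is feasible and has the least number of
blocking edges among all feasible matchings. -/
def IsSolution (M : Finset I.Pair) : Prop :=
  I.Feasible M ∧ ∀ M', I.Feasible M' → (I.bp M).card ≤ (I.bp M').card

/-- The input as a sequence of words: the numbers of men and of women; for each man and then for
each woman the length of the preference list followed by the list; the number of forbidden
edges; the two endpoints of each forbidden edge. -/
def encode : List ℕ :=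
  [I.men, I.women]
    ++ (List.finRange I.men).flatMap
        (fun u => (I.manList u).length :: (I.manList u).map Fin.val)
    ++ (List.finRange I.women).flatMap
        (fun w => (I.womanList w).length :: (I.womanList w).map Fin.val)
    ++ [I.forbidden.length]
    ++ I.forbidden.flatMap (fun e => [e.1.val, e.2.val])

end SMInstance

/-! ### A random access machine: structured programs over registers and arrays, with a step count -/

namespace RAM

/-- Registers `reg x` and random access arrays `arr a 0, arr a 1, …`, holding natural numbers. -/
structure State where
  reg : ℕ → ℕ
  arr : ℕ → ℕ → ℕ

/-- Arithmetic expressions; `get a i` reads cell `i` of array `a`; `sub` is truncated. -/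
inductive Expr where
  | lit (c : ℕ)
  | reg (x : ℕ)
  | get (a : ℕ) (i : Expr)
  | add (e f : Expr)
  | sub (e f : Expr)

namespace Expr

def eval (s : State) : Expr → ℕ
  | lit c => c
  | reg x => s.reg x
  | get a i => s.arr a (i.eval s)
  | add e f => e.eval s + f.eval s
  | sub e f => e.eval s - f.eval s

/-- The number of elementary operations of an evaluation. -/
def cost : Expr → ℕ
  | lit _ => 1
  | reg _ => 1
  | get _ i => i.cost + 1
  | add e f => e.cost + f.cost + 1
  | sub e f => e.cost + f.cost + 1

end Expr

/-- Comparisons of two expressions. -/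
inductive Test where
  | lt (e f : Expr)
  | eq (e f : Expr)

namespace Test

def Holds (s : State) : Test → Prop
  | lt e f => e.eval s < f.eval s
  | eq e f => e.eval s = f.eval s

def cost : Test → ℕ
  | lt e f => e.cost + f.cost + 1
  | eq e f => e.cost + f.cost + 1

end Test

/-- Programs. `assign x e` writes `e` to register `x`; `put a i e` writes `e` to cell `i` of
array `a`; `loop b p` repeats `p` as long as `b` holds. -/
inductive Prog where
  | skip
  | assign (x : ℕ) (e : Expr)
  | put (a : ℕ) (i e : Expr)
  | seq (p q : Prog)
  | branch (b : Test) (p q : Prog)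
  | loop (b : Test) (p : Prog)

namespace State

def setReg (s : State) (x v : ℕ) : State :=
  { s with reg := Function.update s.reg x v }

def setArr (s : State) (a i v : ℕ) : State :=
  { s with arr := Function.update s.arr a (Function.update (s.arr a) i v) }

end State

/-- `Run B p s t s'`: on a machine whose words hold the numbers `0, …, B`, the program `p`
started in state `s` halts in state `s'` after `t` elementary steps. Writing a number larger
than `B`, or writing to an address larger than `B`, is not possible. -/
inductive Run (B : ℕ) : Prog → State → ℕ → State → Prop where
  | skip (s : State) : Run B .skip s 1 s
  | assign (s : State) (x : ℕ) (e : Expr) (h : e.eval s ≤ B) :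
      Run B (.assign x e) s (e.cost + 1) (s.setReg x (e.eval s))
  | put (s : State) (a : ℕ) (i e : Expr) (hi : i.eval s ≤ B) (h : e.eval s ≤ B) :
      Run B (.put a i e) s (i.cost + e.cost + 1) (s.setArr a (i.eval s) (e.eval s))
  | seq {p q : Prog} {s s' s'' : State} {t t' : ℕ}
      (hp : Run B p s t s') (hq : Run B q s' t' s'') : Run B (.seq p q) s (t + t') s''
  | branch_true {b : Test} {p q : Prog} {s s' : State} {t : ℕ}
      (hb : b.Holds s) (hp : Run B p s t s') : Run B (.branch b p q) s (b.cost + t) s'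
  | branch_false {b : Test} {p q : Prog} {s s' : State} {t : ℕ}
      (hb : ¬ b.Holds s) (hq : Run B q s t s') : Run B (.branch b p q) s (b.cost + t) s'
  | loop_true {b : Test} {p : Prog} {s s' s'' : State} {t t' : ℕ}
      (hb : b.Holds s) (hp : Run B p s t s') (hl : Run B (.loop b p) s' t' s'') :
      Run B (.loop b p) s (b.cost + t + t') s''
  | loop_false {b : Test} {p : Prog} {s : State}
      (hb : ¬ b.Holds s) : Run B (.loop b p) s b.cost s

/-- The initial state: the input words are in array `0`, and everything else is `0`. -/
def initial (input : List ℕ) : State where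
  reg := fun _ => 0
  arr := fun a i => if a = 0 then input.getD i 0 else 0

end RAM

namespace SMInstance

/-- In state `s`, array `1` holds the matching `M`: its cell `u` is `w + 1` if man `u` is matched
to woman `w`, and `0` if man `u` is unmatched. -/
def Outputs (I : SMInstance) (s : RAM.State) (M : Finset I.Pair) : Prop :=
  (∀ u w, (u, w) ∈ M → s.arr 1 u.val = w.val + 1) ∧
  (∀ u, (∀ w, (u, w) ∉ M) → s.arr 1 u.val = 0)

/-- On input `I`, with words `0, …, B`, the program `p` halts after at most `T` steps and outputs
a matching that avoids the forbidden edges and has, subject to this, the fewest blocking edges. -/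
def SolvedBy (I : SMInstance) (p : RAM.Prog) (B T : ℕ) : Prop :=
  ∃ (t : ℕ) (s : RAM.State) (M : Finset I.Pair),
    RAM.Run B p (RAM.initial I.encode) t s ∧ t ≤ T ∧ I.Outputs s M ∧ I.IsSolution M

end SMInstance

/-! ### Total correctness with step bounds for the random access machine -/

/-! The proof reduces the optimisation problem to deciding, for each set `D` of at most `L` edges,
whether the graph without `D` has a stable matching that avoids `P`. Such a matching has at most
`|D|` blocking edges in the whole graph (`StableWithout.card_bp_le`). Conversely, every feasible `M`
is stable once `D = bp(M)` is deleted (`Feasible.stableWithout_bp`). The choice `D = P` always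
succeeds, so the optimum is at most `L`, and every feasible matching with at most `L` blocking edges
is accounted for by some `D` in the search (`Found.exists_solution`).

The decision for one `D` is made by deferred acceptance with men proposing. A proposal along a
forbidden edge makes the woman reject everyone worse, but she does not hold the proposer, who goes
on proposing. An entry that a man has passed without being held lies in no admissible stable
matching. If at the end no woman is left empty-handed after a best proposal along a forbidden edge,
the held pairs are stable (`DAState.Inv.stable_matching`). If some woman is, a counting argument on
the women whose partner in a supposed stable matching has not yet proposed to them gives a
contradiction (`DAState.Inv.not_stable`).

The sets `D` are enumerated as `L`-digit numbers in base `m + 1`, where the digit `0` means no edge.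
Since `L ≤ m`, there are `(m + 1) ^ L ≤ 3 * m ^ L` of them (`Nat.succ_pow_le_three_mul`), and each
takes `O(n ^ 2)` steps (`halts_tryDigits`). On the machine, loop-free code is treated by weakest
preconditions, loops by invariants with a decreasing index, and unchanged memory by a syntactic
frame rule. -/

namespace RAM

namespace State

@[simp] theorem setReg_reg (s : State) (x v y : ℕ) :
    (s.setReg x v).reg y = if y = x then v else s.reg y := by
  simp [setReg, Function.update_apply]

@[simp] theorem setReg_arr (s : State) (x v : ℕ) : (s.setReg x v).arr = s.arr := rfl

@[simp] theorem setArr_reg (s : State) (a i v : ℕ) : (s.setArr a i v).reg = s.reg := rfl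

@[simp] theorem setArr_arr (s : State) (a i v b : ℕ) :
    (s.setArr a i v).arr b = if b = a then Function.update (s.arr a) i v else s.arr b := by
  simp only [setArr, Function.update_apply]

end State

/-- The program may write to register `x`. -/
def Prog.writesReg (x : ℕ) : Prog → Bool
  | .skip => false
  | .assign y _ => y == x
  | .put _ _ _ => false
  | .seq p q => p.writesReg x || q.writesReg x
  | .branch _ p q => p.writesReg x || q.writesReg x
  | .loop _ p => p.writesReg x

/-- The program may write to array `a`. -/
def Prog.writesArr (a : ℕ) : Prog → Bool
  | .skip => false
  | .assign _ _ => false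
  | .put b _ _ => b == a
  | .seq p q => p.writesArr a || q.writesArr a
  | .branch _ p q => p.writesArr a || q.writesArr a
  | .loop _ p => p.writesArr a

/-- `s'` differs from `s` only in registers and arrays which `p` may write to. -/
structure Frame (p : Prog) (s s' : State) : Prop where
  reg : ∀ x, p.writesReg x = false → s'.reg x = s.reg x
  arr : ∀ a, p.writesArr a = false → s'.arr a = s.arr a

theorem Frame.refl (p : Prog) (s : State) : Frame p s s := ⟨fun _ _ => rfl, fun _ _ => rfl⟩

theorem Frame.trans {p : Prog} {s s' s'' : State} (h : Frame p s s') (h' : Frame p s' s'') :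
    Frame p s s'' :=
  ⟨fun x hx => (h'.reg x hx).trans (h.reg x hx), fun a ha => (h'.arr a ha).trans (h.arr a ha)⟩

theorem Frame.mono {p q : Prog} {s s' : State} (h : Frame p s s')
    (hr : ∀ x, q.writesReg x = false → p.writesReg x = false)
    (ha : ∀ x, q.writesArr x = false → p.writesArr x = false) : Frame q s s' :=
  ⟨fun x hx => h.reg x (hr x hx), fun a h' => h.arr a (ha a h')⟩

/-- Invariants need mention only what changes: that a concrete program leaves a given register or
array alone is a Boolean computation, usually closed by `rfl`. -/
theorem Run.frame {B : ℕ} {p : Prog} {s s' : State} {t : ℕ} (h : Run B p s t s') :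
    Frame p s s' := by
  induction h with
  | skip s => exact Frame.refl _ _
  | assign s x e h =>
    refine ⟨fun y hy => ?_, fun _ _ => rfl⟩
    have : y ≠ x := by rintro rfl; simp [Prog.writesReg] at hy
    simp [this]
  | put s a i e hi h =>
    refine ⟨fun _ _ => rfl, fun b hb => ?_⟩
    have : b ≠ a := by rintro rfl; simp [Prog.writesArr] at hb
    simp [this]
  | seq _ _ ih ih' =>
    refine (ih.mono ?_ ?_).trans (ih'.mono ?_ ?_) <;> intro x hx <;>
      simp_all [Prog.writesReg, Prog.writesArr]
  | branch_true _ _ ih =>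
    refine ih.mono ?_ ?_ <;> intro x hx <;> simp_all [Prog.writesReg, Prog.writesArr]
  | branch_false _ _ ih =>
    refine ih.mono ?_ ?_ <;> intro x hx <;> simp_all [Prog.writesReg, Prog.writesArr]
  | loop_true _ _ _ ih ih' => exact (Frame.mk ih.reg ih.arr : Frame (.loop _ _) _ _).trans ih'
  | loop_false _ => exact Frame.refl _ _

/-- Started in `s`, the program `p` halts within `T` steps in a state satisfying `Q`. -/
def Halts (B : ℕ) (p : Prog) (s : State) (T : ℕ) (Q : State → Prop) : Prop :=
  ∃ t s', Run B p s t s' ∧ t ≤ T ∧ Q s'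

namespace Halts

variable {B T T₁ T₂ : ℕ} {p q : Prog} {s : State} {Q R : State → Prop}

theorem mono (h : Halts B p s T₁ R) (hT : T₁ ≤ T) (hQ : ∀ s', R s' → Frame p s s' → Q s') :
    Halts B p s T Q := by
  obtain ⟨t, s', hr, ht, h⟩ := h
  exact ⟨t, s', hr, ht.trans hT, hQ _ h hr.frame⟩

theorem seq (hp : Halts B p s T₁ R)
    (hq : ∀ s', R s' → Frame p s s' → Halts B q s' T₂ Q) (hT : T₁ + T₂ ≤ T) :
    Halts B (p.seq q) s T Q := by
  obtain ⟨t, s', hr, ht, h⟩ := hp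
  obtain ⟨t', s'', hr', ht', h'⟩ := hq s' h hr.frame
  exact ⟨t + t', s'', .seq hr hr', by omega, h'⟩

theorem branch {b : Test} (hp : b.Holds s → Halts B p s T₁ Q)
    (hq : ¬ b.Holds s → Halts B q s T₁ Q) (hT : b.cost + T₁ ≤ T) :
    Halts B (.branch b p q) s T Q := by
  by_cases hb : b.Holds s
  · obtain ⟨t, s', hr, ht, h⟩ := hp hb
    exact ⟨_, s', .branch_true hb hr, by omega, h⟩
  · obtain ⟨t, s', hr, ht, h⟩ := hq hb
    exact ⟨_, s', .branch_false hb hr, by omega, h⟩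

/-- Total correctness of a loop: the index of the invariant drops in each round. -/
theorem loop {b : Test} (Inv : ℕ → State → Prop) {k : ℕ} (h0 : Inv k s)
    (hstep : ∀ k s', Frame p s s' → Inv k s' → b.Holds s' →
      Halts B p s' T₁ fun s'' => ∃ k' < k, Inv k' s'')
    (hT : k * (T₁ + b.cost) + b.cost ≤ T) :
    Halts B (.loop b p) s T fun s' => (∃ k, Inv k s') ∧ ¬ b.Holds s' := by
  -- The induction ranges over all states reachable from `s`, with the frame relative to `s` carried
  -- along.
  suffices H : ∀ k s', Frame p s s' → Inv k s' →
      Halts B (.loop b p) s' (k * (T₁ + b.cost) + b.cost)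
        fun s' => (∃ k, Inv k s') ∧ ¬ b.Holds s' from
    (H k s (Frame.refl _ _) h0).mono hT fun _ h _ => h
  intro k
  induction k using Nat.strong_induction_on with
  | _ k ih =>
    intro s' hF hI
    by_cases hb : b.Holds s'
    · obtain ⟨t, s₁, hr, ht, k', hk', hI'⟩ := hstep k s' hF hI hb
      obtain ⟨t', s₂, hr', ht', hQ⟩ := ih k' hk' s₁ (hF.trans hr.frame) hI'
      refine ⟨_, s₂, .loop_true hb hr hr', ?_, hQ⟩
      have : (k' + 1) * (T₁ + b.cost) ≤ k * (T₁ + b.cost) := Nat.mul_le_mul_right _ hk'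
      rw [Nat.succ_mul] at this
      omega
    · exact ⟨_, s', .loop_false hb, by omega, ⟨k, hI⟩, hb⟩

end Halts

/-- Weakest preconditions of loop-free programs. -/
def wp (B : ℕ) : Prog → (State → Prop) → State → Prop
  | .skip, Q, s => Q s
  | .assign x e, Q, s => e.eval s ≤ B ∧ Q (s.setReg x (e.eval s))
  | .put a i e, Q, s => i.eval s ≤ B ∧ e.eval s ≤ B ∧ Q (s.setArr a (i.eval s) (e.eval s))
  | .seq p q, Q, s => wp B p (wp B q Q) s
  | .branch b p q, Q, s => (b.Holds s → wp B p Q s) ∧ (¬ b.Holds s → wp B q Q s)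
  | .loop _ _, _, _ => False

/-- A bound on the number of steps of a loop-free program. -/
def Prog.maxCost : Prog → ℕ
  | .skip => 1
  | .assign _ e => e.cost + 1
  | .put _ i e => i.cost + e.cost + 1
  | .seq p q => p.maxCost + q.maxCost
  | .branch b p q => b.cost + (p.maxCost + q.maxCost)
  | .loop _ _ => 0

/-- Loops are excluded because `wp` is `False` on them, so the value `0` of `maxCost` there is
immaterial. Branches are charged for both sides, which is wasteful but keeps the bound computable by
`decide`. -/
theorem Halts.of_wp {B T : ℕ} {p : Prog} {s : State} {Q : State → Prop} (h : wp B p Q s)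
    (hT : p.maxCost ≤ T) : Halts B p s T Q := by
  refine Halts.mono (T₁ := p.maxCost) (R := Q) ?_ hT fun _ h _ => h
  clear hT
  induction p generalizing s Q with
  | skip => exact ⟨1, s, .skip s, le_rfl, h⟩
  | assign x e => exact ⟨_, _, .assign s x e h.1, le_rfl, h.2⟩
  | put a i e => exact ⟨_, _, .put s a i e h.1 h.2.1, le_rfl, h.2.2⟩
  | seq p q ihp ihq => exact Halts.seq (ihp h) (fun s' h' _ => ihq h') le_rfl
  | branch b p q ihp ihq =>
    exact Halts.branch (T₁ := p.maxCost + q.maxCost)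
      (fun hb => (ihp (h.1 hb)).mono (by omega) fun _ h _ => h)
      (fun hb => (ihq (h.2 hb)).mono (by omega) fun _ h _ => h) le_rfl
  | loop b p => exact h.elim

/-- `for x := 0` to `reg n - 1` do `p`. -/
def forLoop (x n : ℕ) (p : Prog) : Prog :=
  .seq (.assign x (.lit 0))
    (.loop (.lt (.reg x) (.reg n)) (.seq p (.assign x (.add (.reg x) (.lit 1)))))

/-- Each round costs 3 for the test and 4 for the increment beyond the body; the initial assignment
and the failing last test cost 2 + 3. `hInv` says that the invariant does not depend on the counter
register. -/
theorem Halts.for_loop {B T T₁ x n N : ℕ} {p : Prog} {s : State} (Inv : ℕ → State → Prop)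
    (hN : s.reg n = N) (hB : N ≤ B) (hxn : n ≠ x) (hx : p.writesReg x = false)
    (hn : p.writesReg n = false) (h0 : Inv 0 s)
    (hInv : ∀ k s v, Inv k s → Inv k (s.setReg x v))
    (hstep : ∀ k < N, ∀ s', Frame (forLoop x n p) s s' → s'.reg x = k → Inv k s' →
      Halts B p s' T₁ (Inv (k + 1)))
    (hT : N * (T₁ + 7) + 5 ≤ T) :
    Halts B (forLoop x n p) s T (Inv N) := by
  have hbody : ∀ k s', Frame (forLoop x n p) s s' →
      (s'.reg x ≤ N ∧ s'.reg x + k = N ∧ Inv (s'.reg x) s') → s'.reg x < s'.reg n →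
      Halts B (.seq p (.assign x (.add (.reg x) (.lit 1)))) s' (T₁ + 4) fun s'' =>
        ∃ k' < k, s''.reg x ≤ N ∧ s''.reg x + k' = N ∧ Inv (s''.reg x) s'' := by
    rintro k s' hF ⟨h1, h2, h3⟩ h4
    have hn' : s'.reg n = N := by
      rw [hF.reg n, hN]
      simp [RAM.forLoop, Prog.writesReg, hn, hxn.symm]
    refine Halts.seq (hstep _ (hn' ▸ h4) s' hF rfl h3) (fun s'' h5 hF' => ?_) le_rfl
    have := hF'.reg x hx
    refine Halts.of_wp ?_ le_rfl
    simp only [wp, Expr.eval, State.setReg_reg, if_true]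
    exact ⟨by omega, k - 1, by omega, by omega, by omega, hInv _ _ _ (this ▸ h5)⟩
  refine Halts.seq (T₁ := 2) (T₂ := N * (T₁ + 4 + 3) + 3)
    (R := fun s' => s'.reg x = 0 ∧ Inv 0 s')
    (Halts.of_wp ⟨Nat.zero_le _, by simp [Expr.eval], hInv _ _ _ h0⟩ le_rfl) ?_
    (by rw [show T₁ + 4 + 3 = T₁ + 7 from rfl]; omega)
  rintro s₁ ⟨hx0, hI0⟩ hF
  have hFl : ∀ s', Frame (.seq p (.assign x (.add (.reg x) (.lit 1)))) s₁ s' →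
      Frame (RAM.forLoop x n p) s s' := by
    intro s' h
    refine (hF.mono ?_ ?_).trans (h.mono ?_ ?_) <;> intro y hy <;>
      simp_all [RAM.forLoop, Prog.writesReg, Prog.writesArr]
  refine (Halts.loop (T₁ := T₁ + 4) (b := .lt (.reg x) (.reg n))
    (fun k s' => s'.reg x ≤ N ∧ s'.reg x + k = N ∧ Inv (s'.reg x) s') (k := N) ?_
    (fun k s' h => hbody k s' (hFl s' h)) le_rfl).mono le_rfl ?_
  · exact ⟨by omega, by omega, hx0 ▸ hI0⟩
  · rintro s' ⟨⟨k, h1, h2, h3⟩, h4⟩ hF'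
    have hn' : s'.reg n = N := by
      rw [← hN, hF'.reg n, hF.reg n] <;> simp [Prog.writesReg, hn, hxn.symm]
    simp only [Test.Holds, Expr.eval, hn'] at h4
    exact (show s'.reg x = N by omega) ▸ h3

end RAM

/-! ### Stable matchings that avoid forbidden edges -/

namespace SMInstance

variable (I : SMInstance)

/-- `M` is a feasible matching of the graph without the edges in `D` which is stable there. -/
structure StableWithout (D M : Finset I.Pair) : Prop where
  feasible : I.Feasible M
  disjoint : Disjoint M D
  stable : ∀ e, I.Blocks M e → e ∈ D

/-- A state of the deferred acceptance procedure: how many entries of his list each man has dealt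
with, whom each woman holds, the rank of the best proposal she has had, and the free men. -/
structure DAState where
  ptr : Fin I.men → ℕ
  cur : Fin I.women → Option (Fin I.men)
  best : Fin I.women → ℕ
  stack : List (Fin I.men)

/-! ### Deferred acceptance with deleted and forbidden edges -/

namespace DAState

variable {I}

/-- Man `u` has dealt with `w`. -/
def Passed (g : I.DAState) (u : Fin I.men) (w : Fin I.women) : Prop :=
  w ∈ I.manList u ∧ (I.manList u).idxOf w < g.ptr u

/-- The invariant of deferred acceptance on the graph without `D`, where a proposal along a
forbidden edge counts for the woman, while the man remains free. -/
structure Inv (D : Finset I.Pair) (g : I.DAState) : Prop where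
  ptr_le : ∀ u, g.ptr u ≤ (I.manList u).length
  best_le : ∀ u w, g.Passed u w → (u, w) ∉ D → g.best w ≤ (I.womanList w).idxOf u
  cur_some : ∀ u w, g.cur w = some u → g.Passed u w ∧ (u, w) ∉ D ∧
    (I.womanList w).idxOf u = g.best w ∧ (u, w) ∉ I.forbiddenSet ∧
    g.ptr u = (I.manList u).idxOf w + 1
  cur_none : ∀ w, g.cur w = none → g.best w < I.men → ∃ u, g.Passed u w ∧ (u, w) ∉ D ∧
    (I.womanList w).idxOf u = g.best w ∧ (u, w) ∈ I.forbiddenSet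
  impossible : ∀ u w, g.Passed u w → g.cur w ≠ some u → ∀ M, I.StableWithout D M → (u, w) ∉ M
  done : ∀ u, g.ptr u = (I.manList u).length ∨ u ∈ g.stack ∨ ∃ w, g.cur w = some u
  stack_free : ∀ u ∈ g.stack, ∀ w, g.cur w ≠ some u
  nodup : g.stack.Nodup

/-- The initial state. -/
def start (I : SMInstance) : I.DAState where
  ptr := fun _ => 0
  cur := fun _ => none
  -- Every rank on a list is below `I.men`, so this value means that no proposal has counted yet.
  best := fun _ => I.men
  stack := List.finRange I.men

theorem start_inv (D : Finset I.Pair) : (start I).Inv D where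
  ptr_le := by simp [start]
  best_le := by simp [start, Passed]
  cur_some := by simp [start]
  cur_none := by simp [start]
  impossible := by simp [start, Passed]
  done := by simp [start]
  stack_free := by simp [start]
  nodup := List.nodup_finRange _

variable {D : Finset I.Pair} {g : I.DAState}

/-- The best proposal is attained. -/
theorem Inv.exists_best (h : g.Inv D) {w : Fin I.women} (hw : g.best w < I.men) :
    ∃ u, g.Passed u w ∧ (u, w) ∉ D ∧ (I.womanList w).idxOf u = g.best w := by
  rcases hc : g.cur w with _ | u
  · obtain ⟨u, h1, h2, h3, -⟩ := h.cur_none w hc hw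
    exact ⟨u, h1, h2, h3⟩
  · obtain ⟨h1, h2, h3, -⟩ := h.cur_some u w hc
    exact ⟨u, h1, h2, h3⟩

/-- A man can be held only by the woman at the last entry he passed, so all earlier entries are
rejections and fall under `impossible`. -/
theorem Inv.impossible_before (h : g.Inv D) {u : Fin I.men} {w w' : Fin I.women}
    (hp : (I.manList u).idxOf w < g.ptr u) (hw' : w' ∈ I.manList u)
    (hlt : (I.manList u).idxOf w' < (I.manList u).idxOf w) {M : Finset I.Pair}
    (hM : I.StableWithout D M) : (u, w') ∉ M := by
  refine h.impossible u w' ⟨hw', by omega⟩ (fun hc => ?_) M hM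
  have := (h.cur_some u w' hc).2.2.2.2
  omega

theorem _root_.SMInstance.StableWithout.mem_list {M : Finset I.Pair} (hM : I.StableWithout D M)
    {u : Fin I.men} {w : Fin I.women} (h : (u, w) ∈ M) : w ∈ I.manList u := by
  have := hM.feasible.1.subset_edges h
  simpa [edges] using this

/-- If a man cannot get anyone better than `w`, then `w` cannot end up with someone worse. -/
theorem _root_.SMInstance.StableWithout.not_mem_of_better {M : Finset I.Pair}
    (hM : I.StableWithout D M) {u u' : Fin I.men} {w : Fin I.women} (hw : w ∈ I.manList u)
    (hD : (u, w) ∉ D) (hlt : (I.womanList w).idxOf u < (I.womanList w).idxOf u')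
    (hbefore : ∀ w' ∈ I.manList u, (I.manList u).idxOf w' < (I.manList u).idxOf w → (u, w') ∉ M) :
    (u', w) ∉ M := by
  intro hmem
  have hne : (u, w) ∉ M := fun h => by
    have := hM.feasible.1.woman_unique _ h _ hmem rfl
    simp only [Prod.mk.injEq, and_true] at this
    subst this
    omega
  refine hD (hM.stable _ ⟨by simpa [edges] using hw, hne, fun w' hw' => ?_, fun v hv => ?_⟩)
  · have hl := hM.mem_list hw'
    rcases lt_trichotomy ((I.manList u).idxOf w') ((I.manList u).idxOf w) with h | h | h
    · exact absurd hw' (hbefore w' hl h)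
    · rw [List.idxOf_inj hl] at h
      exact absurd (h ▸ hw') hne
    · exact h
  · have := hM.feasible.1.woman_unique _ hv _ hmem rfl
    simp only [Prod.mk.injEq, and_true] at this
    subst this
    exact hlt

/-- The man `x` skips his next entry. -/
def skip (g : I.DAState) (x : Fin I.men) : I.DAState :=
  { g with ptr := Function.update g.ptr x (g.ptr x + 1) }

/-- Woman `w` holds `o` from now on, and the man she held is free again. -/
def take (g : I.DAState) (w : Fin I.women) (r : ℕ) (o : Option (Fin I.men))
    (st : List (Fin I.men)) : I.DAState where
  ptr := g.ptr
  cur := Function.update g.cur w o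
  best := Function.update g.best w r
  stack := st ++ (g.cur w).toList

theorem passed_skip {x u : Fin I.men} {w w' : Fin I.women} (hw : w ∈ I.manList x)
    (hx : (I.manList x).idxOf w = g.ptr x) :
    (g.skip x).Passed u w' ↔ g.Passed u w' ∨ (u = x ∧ w' = w) := by
  by_cases hu : u = x
  · subst hu
    simp only [Passed, skip, Function.update_self, true_and]
    constructor
    · rintro ⟨h1, h2⟩
      rcases Nat.lt_succ_iff_lt_or_eq.1 h2 with h | h
      · exact .inl ⟨h1, h⟩
      · rw [← hx, List.idxOf_inj h1] at h
        exact .inr h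
    · rintro (⟨h1, h2⟩ | rfl)
      · exact ⟨h1, by omega⟩
      · exact ⟨hw, by omega⟩
  · simp [Passed, skip, hu]

theorem Inv.pop {x : Fin I.men} {st : List (Fin I.men)} (h : g.Inv D) (hs : g.stack = st ++ [x])
    (hx : g.ptr x = (I.manList x).length) : Inv D { g with stack := st } where
  ptr_le := h.ptr_le
  best_le := h.best_le
  cur_some := h.cur_some
  cur_none := h.cur_none
  impossible := h.impossible
  done u := by
    rcases h.done u with h1 | h1 | h1
    · exact .inl h1
    · rw [hs, List.mem_append, List.mem_singleton] at h1
      rcases h1 with h1 | rfl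
      · exact .inr (.inl h1)
      · exact .inl hx
    · exact .inr (.inr h1)
  stack_free u hu := h.stack_free u (by simp [hs, hu])
  nodup := by
    have := h.nodup
    rw [hs, List.nodup_append] at this
    exact this.1

/-- The edge is deleted, or the woman has had a proposal at least as good. In the second case the
man behind that proposal can get nobody better, so by `not_mem_of_better` the skipped edge is
impossible. -/
theorem Inv.skip {x : Fin I.men} {w : Fin I.women} (h : g.Inv D) (hx : x ∈ g.stack)
    (hw : w ∈ I.manList x) (hp : (I.manList x).idxOf w = g.ptr x)
    (hr : (x, w) ∈ D ∨ g.best w ≤ (I.womanList w).idxOf x) : (g.skip x).Inv D where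
  ptr_le u := by
    by_cases hu : u = x
    · subst hu
      have := List.idxOf_lt_length_of_mem hw
      simp only [DAState.skip, Function.update_self]
      omega
    · simpa [DAState.skip, hu] using h.ptr_le u
  best_le u w' hpas hD := by
    rw [passed_skip hw hp] at hpas
    rcases hpas with h1 | ⟨rfl, rfl⟩
    · exact h.best_le u w' h1 hD
    · exact hr.resolve_left hD
  cur_some u w' hc := by
    have hu : u ≠ x := by rintro rfl; exact h.stack_free _ hx _ hc
    obtain ⟨h1, h2, h3, h4, h5⟩ := h.cur_some u w' hc
    exact ⟨(passed_skip hw hp).2 (.inl h1), h2, h3, h4, by simpa [DAState.skip, hu] using h5⟩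
  cur_none w' hc hb := by
    obtain ⟨u, h1, h2⟩ := h.cur_none w' hc hb
    exact ⟨u, (passed_skip hw hp).2 (.inl h1), h2⟩
  impossible u w' hpas hc M hM := by
    rw [passed_skip hw hp] at hpas
    rcases hpas with h1 | ⟨rfl, rfl⟩
    · exact h.impossible u w' h1 hc M hM
    · rcases hr with hr | hr
      · exact fun hm => Finset.disjoint_left.1 hM.disjoint hm hr
      · have hlen : (I.womanList w').idxOf u < I.men := by
          have h1 := List.idxOf_lt_length_of_mem ((I.mutual_acceptable u w').1 hw)
          have h2 := (I.womanList_nodup w').length_le_card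
          simp only [Fintype.card_fin] at h2
          omega
        obtain ⟨y, h1, h2, h3⟩ := h.exists_best (lt_of_le_of_lt hr hlen)
        -- Equal ranks would make the best proposer the skipping man himself, who has not yet passed
        -- this woman.
        refine hM.not_mem_of_better h1.1 h2 (lt_of_le_of_ne (h3 ▸ hr) fun he => ?_)
          fun w'' hw'' hlt => h.impossible_before h1.2 hw'' hlt hM
        rw [List.idxOf_inj ((I.mutual_acceptable _ _).1 h1.1)] at he
        subst he
        exact absurd h1.2 (by omega)
  done u := by
    by_cases hu : u = x
    · exact .inr (.inl (hu ▸ hx))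
    · simpa [DAState.skip, hu] using h.done u
  stack_free := h.stack_free
  nodup := h.nodup

/-- The two alternatives in `ho` are the heart of the procedure: along a forbidden edge the woman's
threshold improves but she holds nobody and the man stays free; otherwise she holds him. In both,
the man she held before is freed. -/
theorem Inv.take {x : Fin I.men} {w : Fin I.women} {st : List (Fin I.men)} (h : g.Inv D)
    (hs : g.stack = st ++ [x])
    (hw : w ∈ I.manList x) (hp : (I.manList x).idxOf w = g.ptr x) (hD : (x, w) ∉ D)
    (hr : (I.womanList w).idxOf x < g.best w) {o : Option (Fin I.men)} {st' : List (Fin I.men)}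
    (ho : (x, w) ∈ I.forbiddenSet ∧ o = none ∧ st' = st ++ [x] ∨
      (x, w) ∉ I.forbiddenSet ∧ o = some x ∧ st' = st) :
    ((g.skip x).take w ((I.womanList w).idxOf x) o st').Inv D := by
  have hx : x ∈ g.stack := by simp [hs]
  have hpas : ∀ u w', ((g.skip x).take w ((I.womanList w).idxOf x) o st').Passed u w' ↔
      g.Passed u w' ∨ (u = x ∧ w' = w) := fun u w' => passed_skip hw hp
  have hptr : ∀ u, ((g.skip x).take w ((I.womanList w).idxOf x) o st').ptr u =
      if u = x then g.ptr x + 1 else g.ptr u := fun u => by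
    simp [DAState.take, DAState.skip, Function.update_apply]
  have hcur : ∀ w', ((g.skip x).take w ((I.womanList w).idxOf x) o st').cur w' =
      if w' = w then o else g.cur w' := fun u => by
    simp [DAState.take, DAState.skip, Function.update_apply]
  have hbest : ∀ w', ((g.skip x).take w ((I.womanList w).idxOf x) o st').best w' =
      if w' = w then (I.womanList w).idxOf x else g.best w' := fun u => by
    simp [DAState.take, DAState.skip, Function.update_apply]
  have hstack : ((g.skip x).take w ((I.womanList w).idxOf x) o st').stack =
    st' ++ (g.cur w).toList := rfl
  have hnd := h.nodup
  rw [hs] at hnd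
  refine ⟨fun u => ?_, fun u w' hpas' hD' => ?_, fun u w' hc => ?_, fun w' hc hb => ?_,
    fun u w' hpas' hc M hM => ?_, fun u => ?_, fun u hu w' hc => ?_, ?_⟩
  · rw [hptr]
    split_ifs with hu
    · subst hu
      have := List.idxOf_lt_length_of_mem hw
      omega
    · exact h.ptr_le u
  · rw [hpas] at hpas'
    rw [hbest]
    rcases hpas' with h1 | ⟨rfl, rfl⟩
    · have := h.best_le u w' h1 hD'
      split_ifs with he
      · subst he; omega
      · exact this
    · simp
  · rw [hcur] at hc
    rw [hpas, hbest, hptr]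
    split_ifs at hc with he
    · subst he
      rcases ho with ⟨-, rfl, -⟩ | ⟨hF, rfl, -⟩
      · simp at hc
      · simp only [Option.some.injEq] at hc
        subst hc
        simp [hD, hF, hp]
    · have hu : u ≠ x := by rintro rfl; exact h.stack_free _ hx _ hc
      obtain ⟨h1, h2, h3, h4, h5⟩ := h.cur_some u w' hc
      simp [h1, h2, h3, h4, h5, hu, he]
  · rw [hcur] at hc
    rw [hbest] at hb ⊢
    simp only [hpas]
    split_ifs at hc hb ⊢ with he
    · subst he
      rcases ho with ⟨hF, -, -⟩ | ⟨-, rfl, -⟩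
      · exact ⟨x, .inr ⟨rfl, rfl⟩, hD, rfl, hF⟩
      · simp at hc
    · obtain ⟨u, h1, h2⟩ := h.cur_none w' hc hb
      exact ⟨u, .inl h1, h2⟩
  · rw [hpas] at hpas'
    rw [hcur] at hc
    rcases hpas' with h1 | ⟨rfl, rfl⟩
    · by_cases hcu : g.cur w' = some u
      · have he : w' = w := by
          by_contra he
          simp [he, hcu] at hc
        subst he
        obtain ⟨-, -, h3, -⟩ := h.cur_some u w' hcu
        refine hM.not_mem_of_better hw hD (h3 ▸ hr) fun w'' hw'' hlt => ?_
        refine h.impossible x w'' ⟨hw'', hp ▸ hlt⟩ (h.stack_free _ hx _) M hM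
      · exact h.impossible u w' h1 hcu M hM
    · rcases ho with ⟨hF, -, -⟩ | ⟨-, rfl, -⟩
      · exact fun hm => Finset.disjoint_left.1 hM.feasible.2 hm hF
      · simp at hc
  · rw [hptr, hstack]
    simp only [hcur]
    by_cases hu : u = x
    · subst hu
      rcases ho with ⟨-, -, rfl⟩ | ⟨-, rfl, -⟩
      · simp
      · exact .inr (.inr ⟨w, by simp⟩)
    · simp only [hu, if_false]
      rcases h.done u with h1 | h1 | ⟨w', h1⟩
      · exact .inl h1
      · rw [hs] at h1
        have : u ∈ st := by simpa [hu] using h1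
        rcases ho with ⟨-, -, rfl⟩ | ⟨-, -, rfl⟩ <;> simp [this]
      · by_cases he : w' = w
        · subst he; simp [h1]
        · exact .inr (.inr ⟨w', by simp [he, h1]⟩)
  · rw [hcur] at hc
    rw [hstack, List.mem_append, Option.mem_toList] at hu
    have hst : u ∈ st' → u ∈ g.stack := by
      rcases ho with ⟨-, -, rfl⟩ | ⟨-, -, rfl⟩ <;> simp +contextual [hs]
    split_ifs at hc with he
    · subst he
      rcases ho with ⟨-, rfl, rfl⟩ | ⟨-, rfl, rfl⟩
      · simp at hc
      · simp only [Option.some.injEq] at hc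
        subst hc
        rcases hu with hu | hu
        · rw [List.nodup_append] at hnd
          exact hnd.2.2 _ hu _ (by simp) rfl
        · exact h.stack_free _ hx _ hu
    · rcases hu with hu | hu
      · exact h.stack_free _ (hst hu) _ hc
      -- The displaced man cannot be held elsewhere as well, since his pointer determines the woman
      -- who holds him.
      · have h1 := (h.cur_some u w hu).2.2.2.2
        have h2 := (h.cur_some u w' hc).2.2.2.2
        have h3 : (I.manList u).idxOf w' = (I.manList u).idxOf w := by omega
        rw [List.idxOf_inj (h.cur_some u w' hc).1.1] at h3
        exact he h3
  · rw [hstack]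
    have hst : st'.Nodup ∧ ∀ u ∈ st', u ∈ g.stack := by
      rcases ho with ⟨-, -, rfl⟩ | ⟨-, -, rfl⟩
      · exact ⟨hnd, by simp [hs]⟩
      · exact ⟨(List.nodup_append.1 hnd).1, by simp +contextual [hs]⟩
    refine List.nodup_append.2 ⟨hst.1, by cases g.cur w <;> simp, fun a ha b hb hab => ?_⟩
    subst hab
    exact h.stack_free a (hst.2 a ha) w (by simpa using hb)

open Classical in
/-- The matching of the held pairs. -/
noncomputable def matching (g : I.DAState) : Finset I.Pair :=
  Finset.univ.filter fun e => g.cur e.2 = some e.1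

theorem mem_matching {u : Fin I.men} {w : Fin I.women} :
    (u, w) ∈ g.matching ↔ g.cur w = some u := by
  simp [matching]

/-- At the end, if no woman waits for someone better than a forbidden partner, the held pairs form
a stable matching. -/
theorem Inv.stable_matching (h : g.Inv D) (hs : g.stack = [])
    (hok : ∀ w, g.cur w = none → I.men ≤ g.best w) : I.StableWithout D g.matching := by
  refine ⟨⟨⟨?_, ?_, ?_⟩, ?_⟩, ?_, ?_⟩
  · rintro ⟨u, w⟩ he
    rw [mem_matching] at he
    simpa [edges] using (h.cur_some u w he).1.1
  · rintro ⟨u, w⟩ he ⟨u', w'⟩ he' (rfl : u = u')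
    rw [mem_matching] at he he'
    have h1 := (h.cur_some u w he).2.2.2.2
    have h2 := (h.cur_some u w' he').2.2.2.2
    have h3 : (I.manList u).idxOf w' = (I.manList u).idxOf w := by omega
    rw [List.idxOf_inj (h.cur_some u w' he').1.1] at h3
    rw [h3]
  · rintro ⟨u, w⟩ he ⟨u', w'⟩ he' (rfl : w = w')
    rw [mem_matching] at he he'
    rw [he, Option.some.injEq] at he'
    rw [he']
  · refine Finset.disjoint_left.2 ?_
    rintro ⟨u, w⟩ he
    exact (h.cur_some u w (mem_matching.1 he)).2.2.2.1
  · refine Finset.disjoint_left.2 ?_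
    rintro ⟨u, w⟩ he
    exact (h.cur_some u w (mem_matching.1 he)).2.1
  · rintro ⟨u, w⟩ ⟨he, hM, hman, hwoman⟩
    by_contra hD
    have hw : w ∈ I.manList u := by simpa [edges] using he
    rw [mem_matching] at hM
    simp only [mem_matching] at hman hwoman
    -- If the man passed the woman, she holds someone at least as good. If not, his list is not
    -- exhausted, so he is held by someone earlier on it. Either way the edge does not block.
    by_cases hp : g.Passed u w
    · have hb := h.best_le u w hp hD
      have hlen : (I.womanList w).idxOf u < I.men := by
        have h1 := List.idxOf_lt_length_of_mem ((I.mutual_acceptable u w).1 hw)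
        have h2 := (I.womanList_nodup w).length_le_card
        simp only [Fintype.card_fin] at h2
        omega
      rcases hc : g.cur w with _ | v
      · have := hok w hc
        omega
      · have h1 := hwoman v hc
        have h2 := (h.cur_some v w hc).2.2.1
        simp only [WomanPrefers] at h1
        omega
    · have hp' : g.ptr u ≤ (I.manList u).idxOf w := by
        by_contra hlt
        exact hp ⟨hw, by omega⟩
      have hl := List.idxOf_lt_length_of_mem hw
      rcases h.done u with h1 | h1 | ⟨w', h1⟩
      · omega
      · simp [hs] at h1
      · have h2 := hman w' h1
        have h3 := (h.cur_some u w' h1).2.2.2.2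
        simp only [ManPrefers] at h2
        omega

/-- At the end, if some woman waits for someone better than a forbidden partner, then there is no
feasible stable matching. -/
theorem Inv.not_stable (h : g.Inv D) (hs : g.stack = []) {w₀ : Fin I.women}
    (hc₀ : g.cur w₀ = none) (hb₀ : g.best w₀ < I.men) (M : Finset I.Pair) :
    ¬ I.StableWithout D M := by
  classical
  intro hM
  have hheld : ∀ u w, w ∈ I.manList u → ¬ g.Passed u w →
      ∃ w', g.cur w' = some u := by
    intro u w hw hp
    have hl := List.idxOf_lt_length_of_mem hw
    rcases h.done u with h1 | h1 | h1
    · exact absurd ⟨hw, by omega⟩ hp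
    · simp [hs] at h1
    · exact h1
  -- women matched in `M` to a man who has not proposed to them
  let S : Set (Fin I.women) := {w | ∃ u, (u, w) ∈ M ∧ ¬ g.Passed u w}
  -- If the partner of `w` in `M` had already proposed, he would rank strictly after her best
  -- proposer `u`. As `u` can get nobody better than `w`, the edge `uw` would block `M`; the same
  -- happens if `w` is unmatched.
  have key : ∀ u w, g.Passed u w → (u, w) ∉ D → (u, w) ∉ M →
      (I.womanList w).idxOf u = g.best w → w ∈ S := by
    intro u w hp hD hmem hbest
    by_contra hS
    have hS' : ∀ v, (v, w) ∈ M → g.Passed v w := by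
      intro v hv
      by_contra hp
      exact hS ⟨v, hv, hp⟩
    refine hD (hM.stable _ ⟨by simpa [edges] using hp.1, hmem, fun w' hw' => ?_, fun v hv => ?_⟩)
    · have hl := hM.mem_list hw'
      rcases lt_trichotomy ((I.manList u).idxOf w') ((I.manList u).idxOf w) with h1 | h1 | h1
      · exact absurd hw' (h.impossible_before hp.2 hl h1 hM)
      · rw [List.idxOf_inj hl] at h1
        exact absurd (h1 ▸ hw') hmem
      · exact h1
    · have h1 := h.best_le v w (hS' v hv) fun h => Finset.disjoint_left.1 hM.disjoint hv h
      refine lt_of_le_of_ne (hbest ▸ h1) fun h2 => ?_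
      rw [List.idxOf_inj ((I.mutual_acceptable _ _).1 hp.1)] at h2
      exact hmem (h2 ▸ hv)
  have hw₀ : w₀ ∈ S := by
    obtain ⟨u, h1, h2, h3, h4⟩ := h.cur_none w₀ hc₀ hb₀
    exact key u w₀ h1 h2 (fun hm => Finset.disjoint_left.1 hM.feasible.2 hm h4) h3
  -- Send a woman in `S` to the woman who now holds her partner in `M`. He exists among the held men
  -- because his list is not exhausted, and `key` puts the new woman in `S` again.
  have hf : ∀ w : S, ∃ w' : S, ∃ u, (u, w.1) ∈ M ∧ g.cur w'.1 = some u := by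
    rintro ⟨w, u, hu, hp⟩
    obtain ⟨w', hw'⟩ := hheld u w (hM.mem_list hu) hp
    obtain ⟨h1, h2, h3, -⟩ := h.cur_some u w' hw'
    have hne : (u, w') ∉ M := fun hm => by
      have := hM.feasible.1.man_unique _ hm _ hu rfl
      simp only [Prod.mk.injEq, true_and] at this
      exact hp (this ▸ h1)
    exact ⟨⟨w', key u w' h1 h2 hne h3⟩, u, hu, hw'⟩
  choose f u hfu hfc using hf
  have hinj : Function.Injective f := by
    intro a b hab
    have h1 : u a = u b := by
      have h1 := hfc a
      rw [hab, hfc b, Option.some.injEq] at h1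
      exact h1.symm
    have := hM.feasible.1.man_unique _ (hfu a) _ (hfu b) h1
    simp only [Prod.mk.injEq] at this
    exact Subtype.ext this.2
  -- An injection of the finite set `S` into itself hits `w₀`, but all its values are women who hold
  -- somebody.
  obtain ⟨a, ha⟩ := Finite.surjective_of_injective hinj ⟨w₀, hw₀⟩
  have := hfc a
  rw [ha] at this
  simp [hc₀] at this

/-- If all forbidden edges are deleted, no woman waits for someone better than a forbidden
partner. -/
theorem Inv.le_best_of_subset (h : g.Inv D) (hD : I.forbiddenSet ⊆ D) (w : Fin I.women)
    (hc : g.cur w = none) : I.men ≤ g.best w := by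
  by_contra hlt
  obtain ⟨u, -, h1, -, h2⟩ := h.cur_none w hc (by omega)
  exact h1 (hD h2)

end DAState

/-! ### Reduction to deleted sets of edges -/

variable {I}

theorem mem_bp {M : Finset I.Pair} {e : I.Pair} : e ∈ I.bp M ↔ I.Blocks M e := by
  simp [bp]

theorem StableWithout.card_bp_le {D M : Finset I.Pair} (h : I.StableWithout D M) :
    (I.bp M).card ≤ D.card :=
  Finset.card_le_card fun e he => h.stable e (mem_bp.1 he)

theorem Feasible.stableWithout_bp {M : Finset I.Pair} (h : I.Feasible M) :
    I.StableWithout (I.bp M) M :=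
  ⟨h, Finset.disjoint_right.2 fun _ he => (mem_bp.1 he).2.1, fun _ he => mem_bp.2 he⟩

theorem bp_subset_edges (M : Finset I.Pair) : I.bp M ⊆ I.edges := fun _ he => (mem_bp.1 he).1

theorem forbiddenSet_subset_edges : I.forbiddenSet ⊆ I.edges := fun e he => by
  simpa [edges] using I.forbidden_edge e (by simpa [forbiddenSet] using he)

theorem card_forbiddenSet : I.forbiddenSet.card = I.forbidden.length :=
  List.toFinset_card_of_nodup I.forbidden_nodup

end SMInstance

/-! ### Counting in base `b` -/

/-- With all low digits equal to `b - 1`, the low part is `b ^ i - 1`. Applied to all digits, this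
also detects the end of the enumeration. -/
theorem Nat.mod_pow_add_one_of_digits {b k i : ℕ}
    (h : ∀ j < i, k / b ^ j % b + 1 = b) : k % b ^ i + 1 = b ^ i := by
  induction i with
  | zero => simp [Nat.mod_one]
  | succ i ih =>
    have h1 := ih fun j hj => h j (by omega)
    have h2 := h i (by omega)
    rw [Nat.mod_pow_succ, pow_succ]
    calc k % b ^ i + b ^ i * (k / b ^ i % b) + 1
        = (k % b ^ i + 1) + b ^ i * (k / b ^ i % b) := by ring
      _ = b ^ i * (k / b ^ i % b + 1) := by rw [h1]; ring
      _ = b ^ i * b := by rw [h2]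

/-- This is the carry: dividing the factored form by powers of `b` gives every digit of the
successor. -/
theorem Nat.succ_eq_mul_pow_of_digits {b k i : ℕ}
    (h : ∀ j < i, k / b ^ j % b + 1 = b) : k + 1 = b ^ i * (k / b ^ i + 1) := by
  have h1 := Nat.mod_pow_add_one_of_digits h
  have h2 := Nat.div_add_mod k (b ^ i)
  rw [mul_add]
  omega

/-- Incrementing a number whose lowest `i` digits are maximal: the lowest digits. -/
theorem Nat.succ_digit_of_lt {b k i j : ℕ} (hb : 0 < b) (h : ∀ j < i, k / b ^ j % b + 1 = b)
    (hj : j < i) : (k + 1) / b ^ j % b = 0 := by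
  rw [Nat.succ_eq_mul_pow_of_digits h]
  obtain ⟨c, rfl⟩ := Nat.exists_eq_add_of_lt hj
  rw [show b ^ (j + c + 1) * (k / b ^ (j + c + 1) + 1) =
    b ^ j * (b * (b ^ c * (k / b ^ (j + c + 1) + 1))) by ring,
    Nat.mul_div_cancel_left _ (pow_pos hb j), Nat.mul_mod_right]

/-- Incrementing a number whose lowest `i` digits are maximal: digit `i`. -/
theorem Nat.succ_digit_self {b k i : ℕ} (hb : 0 < b) (h : ∀ j < i, k / b ^ j % b + 1 = b)
    (hi : k / b ^ i % b + 1 < b) : (k + 1) / b ^ i % b = k / b ^ i % b + 1 := by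
  rw [Nat.succ_eq_mul_pow_of_digits h, Nat.mul_div_cancel_left _ (pow_pos hb i), Nat.add_mod]
  rw [Nat.mod_eq_of_lt (a := 1) (by omega), Nat.mod_eq_of_lt hi]

/-- Incrementing a number whose lowest `i` digits are maximal: the digits after digit `i`. -/
theorem Nat.succ_digit_of_gt {b k i j : ℕ} (hb : 0 < b) (h : ∀ j < i, k / b ^ j % b + 1 = b)
    (hi : k / b ^ i % b + 1 < b) (hj : i < j) : (k + 1) / b ^ j % b = k / b ^ j % b := by
  obtain ⟨c, rfl⟩ := Nat.exists_eq_add_of_lt hj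
  have h1 : (k + 1) / b ^ (i + 1) = k / b ^ (i + 1) := by
    rw [pow_succ, ← Nat.div_div_eq_div_mul, ← Nat.div_div_eq_div_mul,
      Nat.succ_eq_mul_pow_of_digits h, Nat.mul_div_cancel_left _ (pow_pos hb i),
      Nat.succ_div_of_not_dvd]
    · intro hd
      have := Nat.mod_eq_zero_of_dvd hd
      rw [Nat.add_mod, Nat.mod_eq_of_lt (a := 1) (by omega), Nat.mod_eq_of_lt hi] at this
      omega
  rw [show i + c + 1 = (i + 1) + c by ring, pow_add, ← Nat.div_div_eq_div_mul, h1,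
    Nat.div_div_eq_div_mul]

/-- If the successor were `b ^ L`, its digit `i` would be `0`, whereas it has just been increased.
-/
theorem Nat.succ_lt_pow_of_digit {b k i L : ℕ} (hb : 0 < b)
    (h : ∀ j < i, k / b ^ j % b + 1 = b) (hi : k / b ^ i % b + 1 < b) (hiL : i < L)
    (hk : k < b ^ L) : k + 1 < b ^ L := by
  refine lt_of_le_of_ne hk fun he => ?_
  have h1 := Nat.succ_digit_self hb h hi
  obtain ⟨c, rfl⟩ := Nat.exists_eq_add_of_lt hiL
  rw [he, show b ^ (i + c + 1) = b ^ i * (b * b ^ c) by ring,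
    Nat.mul_div_cancel_left _ (pow_pos hb i), Nat.mul_mod_right] at h1
  omega

/-- The quotient is `(1 + 1/m) ^ L ≤ exp (L/m) ≤ e < 3`. This replaces the number of digit sequences
by `m ^ L` with a constant independent of `L`. -/
theorem Nat.succ_pow_le_three_mul {m L : ℕ} (h : L ≤ m) : (m + 1) ^ L ≤ 3 * m ^ L := by
  rcases Nat.eq_zero_or_pos m with rfl | hm
  · obtain rfl : L = 0 := by omega
    simp
  have hm' : (0 : ℝ) < m := by exact_mod_cast hm
  have h1 : (1 + 1 / (m : ℝ)) ^ L ≤ 3 := by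
    calc (1 + 1 / (m : ℝ)) ^ L ≤ (Real.exp (1 / m)) ^ L := by
          gcongr
          rw [add_comm]
          exact Real.add_one_le_exp _
      _ = Real.exp (L * (1 / m)) := by rw [← Real.exp_nat_mul]
      _ ≤ Real.exp 1 := by
          rw [Real.exp_le_exp, mul_one_div, div_le_one hm']
          exact_mod_cast h
      _ ≤ 3 := by linarith [Real.exp_one_lt_d9]
  have h2 : ((m : ℝ) + 1) ^ L ≤ 3 * (m : ℝ) ^ L := by
    calc ((m : ℝ) + 1) ^ L = (1 + 1 / (m : ℝ)) ^ L * (m : ℝ) ^ L := by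
          rw [← mul_pow]
          congr 1
          field_simp
      _ ≤ 3 * (m : ℝ) ^ L := by gcongr
  exact_mod_cast h2

/-! ### Numbered edges and numbered sets of deleted edges -/

namespace SMInstance

variable (I : SMInstance)

/-- The position of a pair in the table of all pairs. -/
def code (e : I.Pair) : ℕ := e.1.val * I.women + e.2.val

theorem code_lt (e : I.Pair) : I.code e < I.men * I.women := by
  have h1 : (e.1.val + 1) * I.women ≤ I.men * I.women := Nat.mul_le_mul_right _ e.1.2
  have h2 := e.2.2
  rw [add_mul, one_mul] at h1
  unfold code
  omega

theorem code_injective : Function.Injective I.code := by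
  rintro ⟨u, w⟩ ⟨u', w'⟩ h
  simp only [code] at h
  have h0 : 0 < I.women := w.pos
  have h1 : u.val = u'.val := by
    have := congrArg (· / I.women) h
    simpa [Nat.add_div_of_dvd_right, Nat.mul_add_div, mul_comm _ I.women, h0,
      Nat.div_eq_of_lt w.2, Nat.div_eq_of_lt w'.2] using this
  have h2 : w.val = w'.val := by
    rw [h1] at h
    omega
  exact Prod.ext (Fin.ext h1) (Fin.ext h2)

/-- The edges in the order of the men's lists. -/
def edgeList : List I.Pair := (List.finRange I.men).flatMap fun u => (I.manList u).map (Prod.mk u)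

theorem mem_edgeList {e : I.Pair} : e ∈ I.edgeList ↔ e ∈ I.edges := by
  obtain ⟨u, w⟩ := e
  simp [edgeList, edges]

theorem edgeList_nodup : I.edgeList.Nodup := by
  rw [edgeList, List.nodup_flatMap]
  refine ⟨fun u _ => (I.manList_nodup u).map (Prod.mk_right_injective u), ?_⟩
  refine (List.nodup_finRange _).imp fun {u v} huv => ?_
  rintro e he he'
  simp only [List.mem_map] at he he'
  obtain ⟨w, -, rfl⟩ := he
  obtain ⟨w', -, h⟩ := he'
  exact huv (congrArg Prod.fst h).symm

theorem length_edgeList : I.edgeList.length = I.numEdges := by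
  rw [numEdges, ← List.toFinset_card_of_nodup I.edgeList_nodup]
  congr 1
  ext e
  rw [List.mem_toFinset, mem_edgeList]

/-- The edge with number `j`, counted from `1`. -/
def edgeAt (j : ℕ) : Option I.Pair := if j = 0 then none else I.edgeList[j - 1]?

/-- Digit `i` of `k` in base `m + 1`. -/
def digit (k i : ℕ) : ℕ := k / (I.numEdges + 1) ^ i % (I.numEdges + 1)

theorem digit_le (k i : ℕ) : I.digit k i ≤ I.numEdges :=
  Nat.lt_succ_iff.1 (Nat.mod_lt _ (Nat.succ_pos _))

/-- The edges whose numbers are the digits of `k` before digit `i`. -/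
def deletedList (k i : ℕ) : List I.Pair := (List.range i).filterMap fun j => I.edgeAt (I.digit k j)

theorem deletedList_zero (k : ℕ) : I.deletedList k 0 = [] := rfl

theorem deletedList_succ (k i : ℕ) : I.deletedList k (i + 1) =
    I.deletedList k i ++ (I.edgeAt (I.digit k i)).toList := by
  rw [deletedList, List.range_succ, List.filterMap_append]
  congr 1

/-- The set of edges whose numbers are among the `L` digits of `k`. -/
def deleted (k : ℕ) : Finset I.Pair := (I.deletedList k I.forbidden.length).toFinset

theorem _root_.List.filterMap_range_getElem? {α : Type*} (l : List α) (n : ℕ) :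
    (List.range n).filterMap (fun i => l[i]?) = l.take n := by
  induction n with
  | zero => simp
  | succ n ih =>
    rw [List.range_succ, List.filterMap_append, ih, List.take_add_one]
    congr 1

/-- List `D` without repetition, use the edge numbers as the first digits and pad with `0`. The
length statement matters because the machine compares numbers of nonzero digits, not cardinalities.
-/
theorem exists_deleted_eq {D : Finset I.Pair} (hD : D ⊆ I.edges)
    (hL : D.card ≤ I.forbidden.length) :
    ∃ k < (I.numEdges + 1) ^ I.forbidden.length, I.deleted k = D ∧
      (I.deletedList k I.forbidden.length).length = D.card := by
  classical
  have hmem : ∀ i (h : i < D.toList.length), D.toList[i] ∈ I.edgeList := fun i h =>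
    I.mem_edgeList.2 (hD (Finset.mem_toList.1 (List.getElem_mem h)))
  let f : Fin I.forbidden.length → Fin (I.numEdges + 1) := fun i =>
    if h : i.val < D.toList.length then
      ⟨I.edgeList.idxOf D.toList[i.val] + 1, by
        rw [← length_edgeList]
        exact Nat.succ_lt_succ (List.idxOf_lt_length_of_mem (hmem _ h))⟩
    else 0
  refine ⟨finFunctionFinEquiv f, (finFunctionFinEquiv f).2, ?_⟩
  have hdig : ∀ i (hi : i < I.forbidden.length),
      I.edgeAt (I.digit (finFunctionFinEquiv f) i) = D.toList[i]? := by
    intro i hi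
    have h1 : I.digit (finFunctionFinEquiv f) i = f ⟨i, hi⟩ := by
      -- The inverse of `finFunctionFinEquiv` is given by the same digit formula as `digit`, so
      -- `rfl` finishes.
      conv_rhs => rw [← finFunctionFinEquiv.symm_apply_apply f]
      rfl
    rw [h1]
    by_cases h : i < D.toList.length
    · have h2 := List.idxOf_lt_length_of_mem (hmem i h)
      simp only [f, h, dif_pos, edgeAt, Nat.add_one_ne_zero, if_false, Nat.add_sub_cancel,
        List.getElem?_eq_getElem h2, List.getElem?_eq_getElem h, List.getElem_idxOf]
    · simp only [f, h, dif_neg, not_false_eq_true, edgeAt, Fin.val_zero, if_true]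
      exact (List.getElem?_eq_none (by omega)).symm
  have hlist : I.deletedList (finFunctionFinEquiv f) I.forbidden.length = D.toList := by
    rw [deletedList, List.filterMap_congr (g := fun i => D.toList[i]?)
      (fun i hi => hdig i (List.mem_range.1 hi)), List.filterMap_range_getElem?,
      List.take_of_length_le (by simpa using hL)]
  exact ⟨by rw [deleted, hlist, Finset.toList_toFinset], by rw [hlist, Finset.length_toList]⟩

end SMInstance

/-! ### The program -/

namespace RAM

infixr:60 " ⨾ " => Prog.seq

notation "rMen" => (0 : ℕ)
notation "rWomen" => (1 : ℕ)
notation "rForb" => (2 : ℕ)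
notation "rEdges" => (3 : ℕ)
notation "rPos" => (4 : ℕ)
notation "rOuter" => (5 : ℕ)
notation "rInner" => (6 : ℕ)
notation "rLen" => (7 : ℕ)
notation "rRow" => (8 : ℕ)
notation "rCode" => (9 : ℕ)
notation "rCount" => (10 : ℕ)
notation "rTop" => (11 : ℕ)
notation "rMan" => (12 : ℕ)
notation "rWoman" => (13 : ℕ)
notation "rOld" => (14 : ℕ)
notation "rOk" => (15 : ℕ)
notation "rBest" => (16 : ℕ)
notation "rDone" => (17 : ℕ)

notation "aIn" => (0 : ℕ)
notation "aOut" => (1 : ℕ)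
notation "aStart" => (2 : ℕ)
notation "aLen" => (3 : ℕ)
notation "aRow" => (4 : ℕ)
notation "aRank" => (5 : ℕ)
notation "aForb" => (6 : ℕ)
notation "aEdge" => (7 : ℕ)
notation "aDigit" => (8 : ℕ)
notation "aDel" => (9 : ℕ)
notation "aPtr" => (10 : ℕ)
notation "aStack" => (11 : ℕ)
notation "aCur" => (12 : ℕ)
notation "aBest" => (13 : ℕ)

open RAM.Expr in
/-- Number the edge given by the next entry of the current man's list. -/
def readManEntry : Prog :=
  .assign rEdges (add (reg rEdges) (lit 1)) ⨾
  .put aEdge (reg rEdges) (add (reg rRow) (get aIn (reg rPos))) ⨾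
  .assign rPos (add (reg rPos) (lit 1))

open RAM.Expr in
/-- Read the list of the current man. -/
def readMan : Prog :=
  (.put aLen (reg rOuter) (get aIn (reg rPos)) ⨾
    .assign rLen (get aIn (reg rPos)) ⨾
    .assign rPos (add (reg rPos) (lit 1)) ⨾
    .put aStart (reg rOuter) (reg rPos) ⨾
    .put aRow (reg rOuter) (reg rRow)) ⨾
  forLoop rInner rLen readManEntry ⨾
  .assign rRow (add (reg rRow) (reg rWomen))

open RAM.Expr in
/-- Store the rank given by the next entry of the current woman's list. -/
def readWomanEntry : Prog :=
  .put aRank (add (get aRow (get aIn (reg rPos))) (reg rOuter)) (reg rInner) ⨾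
  .assign rPos (add (reg rPos) (lit 1))

open RAM.Expr in
/-- Read the list of the current woman. -/
def readWoman : Prog :=
  (.assign rLen (get aIn (reg rPos)) ⨾ .assign rPos (add (reg rPos) (lit 1))) ⨾
  forLoop rInner rLen readWomanEntry

open RAM.Expr in
/-- Read the next forbidden edge. -/
def readForb : Prog :=
  .put aForb (add (get aRow (get aIn (reg rPos))) (get aIn (add (reg rPos) (lit 1)))) (lit 1) ⨾
  .assign rPos (add (reg rPos) (lit 2))

open RAM.Expr in
/-- Read the input. -/
def load : Prog :=
  (.assign rMen (get aIn (lit 0)) ⨾ .assign rWomen (get aIn (lit 1)) ⨾ .assign rPos (lit 2)) ⨾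
  forLoop rOuter rMen readMan ⨾
  forLoop rOuter rWomen readWoman ⨾
  (.assign rForb (get aIn (reg rPos)) ⨾ .assign rPos (add (reg rPos) (lit 1)) ⨾
    -- The value `m + 1` is not a digit and stops the carry loop after the last position; the
    -- initial best count `L + 1` means that nothing has been found.
    .put aDigit (reg rForb) (add (reg rEdges) (lit 1)) ⨾
    .assign rBest (add (reg rForb) (lit 1))) ⨾
  forLoop rOuter rForb readForb

/-- The cells from `pos` on hold the list `l`. -/
def Reads (f : ℕ → ℕ) (pos : ℕ) (l : List ℕ) : Prop :=
  ∀ i (h : i < l.length), f (pos + i) = l[i]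

theorem Reads.head {f : ℕ → ℕ} {pos a : ℕ} {l : List ℕ} (h : Reads f pos (a :: l)) :
    f pos = a := h 0 (by simp)

theorem Reads.tail {f : ℕ → ℕ} {pos a : ℕ} {l : List ℕ} (h : Reads f pos (a :: l)) :
    Reads f (pos + 1) l := fun i hi => by
  have := h (i + 1) (by simpa using hi)
  rw [show pos + 1 + i = pos + (i + 1) by ring, this]
  simp

theorem Reads.left {f : ℕ → ℕ} {pos : ℕ} {l l' : List ℕ} (h : Reads f pos (l ++ l')) :
    Reads f pos l := fun i hi => by
  rw [h i (by simp; omega), List.getElem_append_left hi]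

theorem Reads.snoc {f : ℕ → ℕ} {pos v i : ℕ} {l : List ℕ} (h : Reads f pos l)
    (hi : i = pos + l.length) : Reads (Function.update f i v) pos (l ++ [v]) := fun j hj => by
  subst hi
  rw [List.length_append, List.length_singleton] at hj
  by_cases hjl : j < l.length
  · rw [List.getElem_append_left hjl, Function.update_of_ne (by omega), h j hjl]
  · obtain rfl : j = l.length := by omega
    simp

/-- The part `l` of the input has yet to be read. -/
structure Pending (B : ℕ) (s : State) (l : List ℕ) : Prop where
  reads : Reads (s.arr aIn) (s.reg rPos) l
  le : s.reg rPos + l.length ≤ B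

theorem Pending.step {B a : ℕ} {s s' : State} {l : List ℕ} (h : Pending B s (a :: l))
    (ha : s'.arr aIn = s.arr aIn) (hr : s'.reg rPos = s.reg rPos + 1) : Pending B s' l := by
  refine ⟨by rw [ha, hr]; exact h.reads.tail, ?_⟩
  have := h.le
  rw [List.length_cons] at this
  omega

theorem Pending.congr {B : ℕ} {s s' : State} {l : List ℕ} (h : Pending B s l)
    (ha : s'.arr aIn = s.arr aIn) (hr : s'.reg rPos = s.reg rPos) : Pending B s' l :=
  ⟨by rw [ha, hr]; exact h.reads, by rw [hr]; exact h.le⟩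

end RAM

/-! ### Reading the input: correctness and step count -/

namespace SMInstance

open RAM

variable (I : SMInstance)

/-- The numbers `0, …, B` suffice for the input and for addressing the table of all pairs. -/
def Fits (B : ℕ) : Prop := I.encode.length + I.men * I.women + I.men + I.women + 2 ≤ B

/-- The list of man `u` has been read. -/
structure LoadedMan (s : State) (u : Fin I.men) : Prop where
  len : s.arr aLen u.val = (I.manList u).length
  list : Reads (s.arr aIn) (s.arr aStart u.val) ((I.manList u).map Fin.val)
  row : s.arr aRow u.val = u.val * I.women

/-- The input has been read. -/
structure Loaded (s : State) : Prop where
  men : s.reg rMen = I.men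
  women : s.reg rWomen = I.women
  forb : s.reg rForb = I.forbidden.length
  edges : s.reg rEdges = I.numEdges
  man : ∀ u, I.LoadedMan s u
  rank : ∀ u w, w ∈ I.manList u → s.arr aRank (I.code (u, w)) = (I.womanList w).idxOf u
  forbidden : ∀ e, s.arr aForb (I.code e) = if e ∈ I.forbiddenSet then 1 else 0
  edge : Reads (s.arr aEdge) 1 (I.edgeList.map I.code)

variable {I}

theorem length_manList_le (u : Fin I.men) : (I.manList u).length ≤ I.women := by
  simpa using (I.manList_nodup u).length_le_card

theorem length_womanList_le (w : Fin I.women) : (I.womanList w).length ≤ I.men := by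
  simpa using (I.womanList_nodup w).length_le_card

theorem numEdges_le : I.numEdges ≤ I.men * I.women := by
  simpa [numEdges] using Finset.card_le_univ I.edges

theorem length_forbidden_le : I.forbidden.length ≤ I.numEdges := by
  rw [← card_forbiddenSet]
  exact Finset.card_le_card forbiddenSet_subset_edges

theorem LoadedMan.congr {s s' : State} {u : Fin I.men} (h : I.LoadedMan s u)
    (h0 : s'.arr aIn = s.arr aIn) (h1 : s'.arr aStart u = s.arr aStart u)
    (h2 : s'.arr aLen u = s.arr aLen u) (h3 : s'.arr aRow u = s.arr aRow u) :
    I.LoadedMan s' u :=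
  ⟨by rw [h2, h.len], by rw [h0, h1]; exact h.list, by rw [h3, h.row]⟩

/-- The numbering of the memory is chosen so that the tables of the instance occupy registers below
4 and arrays below 8, apart from the output array 1. Later code writes none of them. -/
theorem Loaded.congr {s s' : State} (h : I.Loaded s)
    (hr : ∀ x < 4, s'.reg x = s.reg x) (ha : ∀ a < 8, a ≠ 1 → s'.arr a = s.arr a) :
    I.Loaded s' := by
  refine ⟨by rw [hr _ (by norm_num), h.men], by rw [hr _ (by norm_num), h.women],
    by rw [hr _ (by norm_num), h.forb], by rw [hr _ (by norm_num), h.edges],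
    fun u => (h.man u).congr ?_ ?_ ?_ ?_, ?_, ?_, ?_⟩
  · rw [ha _ (by norm_num) (by norm_num)]
  · rw [ha _ (by norm_num) (by norm_num)]
  · rw [ha _ (by norm_num) (by norm_num)]
  · rw [ha _ (by norm_num) (by norm_num)]
  · rw [ha _ (by norm_num) (by norm_num)]; exact h.rank
  · rw [ha _ (by norm_num) (by norm_num)]; exact h.forbidden
  · rw [ha _ (by norm_num) (by norm_num)]; exact h.edge

theorem halts_readManEntries {B : ℕ} (hB : I.Fits B) {s : State} {u : Fin I.men}
    {pre : List I.Pair} {rest : List ℕ}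
    (hp : Pending B s ((I.manList u).map Fin.val ++ rest)) (hl : s.reg rLen = (I.manList u).length)
    (hrow : s.reg rRow = u.val * I.women) (he : s.reg rEdges = pre.length)
    (hpre : pre.length + (I.manList u).length ≤ I.numEdges)
    (hr : Reads (s.arr aEdge) 1 (pre.map I.code)) :
    Halts B (forLoop rInner rLen readManEntry) s (I.women * 27 + 5) fun s' =>
      Pending B s' rest ∧ s'.reg rEdges = pre.length + (I.manList u).length ∧
      Reads (s'.arr aEdge) 1 ((pre ++ (I.manList u).map (Prod.mk u)).map I.code) := by
  have hm := I.numEdges_le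
  have hlw := I.length_manList_le u
  unfold Fits at hB
  -- A body bound of 20 is generous and is checked by `decide`; with the overhead 7 of the loop it
  -- gives the factor 27.
  refine (Halts.for_loop (T₁ := 20) (N := (I.manList u).length) (fun k s' =>
    Pending B s' (((I.manList u).drop k).map Fin.val ++ rest) ∧ s'.reg rEdges = pre.length + k ∧
      Reads (s'.arr aEdge) 1 ((pre ++ ((I.manList u).take k).map (Prod.mk u)).map I.code))
    hl (by omega) (by norm_num) rfl rfl ?_ ?_ ?_ ?_).mono le_rfl ?_
  · simpa [he, hr] using hp
  · exact fun k s v h => ⟨h.1.congr rfl rfl, h.2⟩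
  · rintro k hk s' hF hx ⟨h1, h2, h3⟩
    have hrow' : s'.reg rRow = u.val * I.women := by rw [hF.reg _ rfl, hrow]
    rw [List.drop_eq_getElem_cons hk, List.map_cons, List.cons_append] at h1
    have hc := I.code_lt (u, (I.manList u)[k])
    have hpos := h1.le
    have hhead := h1.reads.head
    rw [List.length_cons] at hpos
    refine Halts.of_wp ?_ (by decide)
    simp only [code] at hc
    simp [wp, readManEntry, Expr.eval, hhead, hrow', h2, -List.map_drop, -List.map_take]
    refine ⟨by omega, by omega, by omega, h1.step (by simp) (by simp), by omega, ?_⟩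
    have := h3.snoc (v := u.val * I.women + ((I.manList u)[k]).val) (i := pre.length + k + 1)
      (by simp; omega)
    have e : (pre ++ ((I.manList u).take (k + 1)).map (Prod.mk u)).map I.code =
        (pre ++ ((I.manList u).take k).map (Prod.mk u)).map I.code ++
          [u.val * I.women + ((I.manList u)[k]).val] := by
      rw [List.take_add_one, List.getElem?_eq_getElem hk, List.map_append, List.map_append,
        List.map_append, List.map_append, List.append_assoc]
      rfl
    rw [← e] at this
    simpa using this
  · have : (I.manList u).length * (20 + 7) ≤ I.women * 27 := Nat.mul_le_mul_right _ hlw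
    omega
  · rintro s' ⟨h1, h2, h3⟩ -
    refine ⟨by simpa using h1, h2, by simpa using h3⟩

/-- The machine cannot multiply, so the row offset is accumulated by adding the number of women once
per man. Storing it makes every later computation of a pair's code a single addition. -/
theorem halts_readMan {B : ℕ} (hB : I.Fits B) {s : State} {u : Fin I.men}
    {pre : List I.Pair} {rest : List ℕ} (hwomen : s.reg rWomen = I.women)
    (hp : Pending B s ((I.manList u).length :: (I.manList u).map Fin.val ++ rest))
    (hu : s.reg rOuter = u) (hrow : s.reg rRow = u.val * I.women)
    (he : s.reg rEdges = pre.length)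
    (hpre : pre.length + (I.manList u).length ≤ I.numEdges)
    (hr : Reads (s.arr aEdge) 1 (pre.map I.code)) (hman : ∀ v < u, I.LoadedMan s v) :
    Halts B readMan s (I.women * 27 + 40) fun s' =>
      Pending B s' rest ∧ s'.reg rEdges = pre.length + (I.manList u).length ∧
      Reads (s'.arr aEdge) 1 ((pre ++ (I.manList u).map (Prod.mk u)).map I.code) ∧
      s'.reg rRow = (u.val + 1) * I.women ∧ ∀ v ≤ u, I.LoadedMan s' v := by
  have hlw := I.length_manList_le u
  have hpos := hp.le
  have hhead := hp.reads.head
  have hmul : (u.val + 1) * I.women ≤ I.men * I.women := Nat.mul_le_mul_right _ u.2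
  have hu' := u.2
  have hB' := hB
  unfold Fits at hB
  rw [add_mul, one_mul] at hmul
  simp only [List.cons_append, List.length_cons] at hpos
  refine Halts.seq (T₁ := 20) (T₂ := I.women * 27 + 5 + 4)
    (R := fun s' => Pending B s' ((I.manList u).map Fin.val ++ rest) ∧
      s'.reg rLen = (I.manList u).length ∧ (∀ v ≤ u, I.LoadedMan s' v)) ?_ ?_ (by omega)
  · refine Halts.of_wp ?_ (by decide)
    simp [wp, Expr.eval, hhead, hu, hrow]
    refine ⟨by omega, by omega, by omega, by omega, by omega, by omega, by omega,
      hp.step (by simp) (by simp), fun v hv => ?_⟩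
    rcases hv.lt_or_eq with hlt | rfl
    · have hne : v.val ≠ u.val := by
        have := Fin.lt_def.1 hlt
        omega
      refine (hman v hlt).congr ?_ ?_ ?_ ?_ <;> simp [hne]
    · refine ⟨by simp, ?_, by simp⟩
      simpa using hp.reads.tail.left
  · rintro s₁ ⟨h1, h2, h3⟩ hF
    refine Halts.seq (halts_readManEntries hB' h1 h2 (by rw [hF.reg _ rfl, hrow])
      (by rw [hF.reg _ rfl, he]) hpre (by rw [hF.arr _ rfl]; exact hr)) ?_ le_rfl
    rintro s₂ ⟨h4, h5, h6⟩ hF'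
    have hw : s₂.reg rWomen = I.women := by rw [hF'.reg _ rfl, hF.reg _ rfl, hwomen]
    have hrow' : s₂.reg rRow = u.val * I.women := by rw [hF'.reg _ rfl, hF.reg _ rfl, hrow]
    refine Halts.of_wp ?_ (by decide)
    simp [wp, Expr.eval, hw, hrow', h5]
    refine ⟨by omega, h4.congr rfl (by simp), by simpa using h6, by ring, fun v hv => ?_⟩
    refine (h3 v hv).congr ?_ ?_ ?_ ?_ <;> simp [hF'.arr aIn rfl, hF'.arr aStart rfl,
      hF'.arr aLen rfl, hF'.arr aRow rfl]

/-- The part of the input which describes man `u`. -/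
def manWords (I : SMInstance) (u : Fin I.men) : List ℕ := (I.manList u).length :: (I.manList u).map Fin.val

/-- The part of the input which describes woman `w`. -/
def womanWords (I : SMInstance) (w : Fin I.women) : List ℕ :=
  (I.womanList w).length :: (I.womanList w).map Fin.val

/-- The edges at the first `k` men. -/
def edgesBefore (I : SMInstance) (k : ℕ) : List I.Pair :=
  ((List.finRange I.men).take k).flatMap fun u => (I.manList u).map (Prod.mk u)

theorem edgesBefore_succ {k : ℕ} (hk : k < I.men) : I.edgesBefore (k + 1) =
    I.edgesBefore k ++ (I.manList ⟨k, hk⟩).map (Prod.mk ⟨k, hk⟩) := by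
  rw [edgesBefore, List.take_add_one, List.flatMap_append,
    List.getElem?_eq_getElem (by simpa using hk)]
  simp [edgesBefore]

theorem edgesBefore_men : I.edgesBefore I.men = I.edgeList := by
  rw [edgesBefore, edgeList, List.take_of_length_le (by simp)]

theorem length_edgesBefore_le (k : ℕ) : (I.edgesBefore k).length ≤ I.numEdges := by
  rw [← length_edgeList]
  exact (((List.take_sublist _ _).flatMap _)).length_le

theorem drop_finRange {n k : ℕ} (hk : k < n) :
    (List.finRange n).drop k = ⟨k, hk⟩ :: (List.finRange n).drop (k + 1) := by
  rw [List.drop_eq_getElem_cons (by simpa using hk)]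
  simp

theorem halts_readMen {B : ℕ} (hB : I.Fits B) {s : State} {rest : List ℕ}
    (hmen : s.reg rMen = I.men) (hwomen : s.reg rWomen = I.women)
    (hp : Pending B s ((List.finRange I.men).flatMap I.manWords ++ rest))
    (hrow : s.reg rRow = 0) (he : s.reg rEdges = 0) :
    Halts B (forLoop rOuter rMen readMan) s (I.men * (I.women * 27 + 47) + 5) fun s' =>
      Pending B s' rest ∧ s'.reg rEdges = I.numEdges ∧
      Reads (s'.arr aEdge) 1 (I.edgeList.map I.code) ∧ ∀ u, I.LoadedMan s' u := by
  have hB' := hB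
  unfold Fits at hB
  refine (Halts.for_loop (T₁ := I.women * 27 + 40) (N := I.men) (fun k s' =>
    Pending B s' (((List.finRange I.men).drop k).flatMap I.manWords ++ rest) ∧
      s'.reg rEdges = (I.edgesBefore k).length ∧
      Reads (s'.arr aEdge) 1 ((I.edgesBefore k).map I.code) ∧
      s'.reg rRow = k * I.women ∧ ∀ u : Fin I.men, u.val < k → I.LoadedMan s' u)
    hmen (by omega) (by norm_num) rfl rfl ?_ ?_ ?_ le_rfl).mono le_rfl ?_
  · refine ⟨by simpa using hp, by simp [edgesBefore, he], ?_, by simp [hrow], by simp⟩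
    intro i hi
    simp [edgesBefore] at hi
  · exact fun k s v h => ⟨h.1.congr rfl rfl, h.2.1, h.2.2.1, h.2.2.2.1,
      fun u hu => (h.2.2.2.2 u hu).congr rfl rfl rfl rfl⟩
  · rintro k hk s' hF hx ⟨h1, h2, h3, h4, h5⟩
    rw [drop_finRange hk, List.flatMap_cons, List.append_assoc] at h1
    have hlen := I.length_edgesBefore_le (k + 1)
    rw [edgesBefore_succ hk, List.length_append, List.length_map] at hlen
    refine (halts_readMan (u := ⟨k, hk⟩) hB' (by rw [hF.reg _ rfl, hwomen]) h1 hx h4 h2 hlen h3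
      (fun v hv => h5 v hv)).mono le_rfl ?_
    rintro s'' ⟨h1, h2, h3, h4, h5⟩ -
    rw [edgesBefore_succ hk]
    exact ⟨h1, by simpa using h2, h3, h4, fun u hu => h5 u (Nat.lt_succ_iff.1 hu)⟩
  · rintro s' ⟨h1, h2, h3, -, h5⟩ -
    rw [edgesBefore_men] at h2 h3
    exact ⟨by simpa [List.drop_of_length_le] using h1, by rw [h2, length_edgeList], h3, fun u => h5 u u.2⟩

/-- Ranks are filed under pair codes, so that a woman compares two men in constant time. Injectivity
of `code` keeps ranks stored earlier intact. -/
theorem halts_readWoman {B : ℕ} (hB : I.Fits B) {s : State} {w : Fin I.women} {rest : List ℕ}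
    (hp : Pending B s (I.womanWords w ++ rest)) (hw : s.reg rOuter = w)
    (hman : ∀ u, I.LoadedMan s u)
    (hrank : ∀ u v, v < w → v ∈ I.manList u →
      s.arr aRank (I.code (u, v)) = (I.womanList v).idxOf u) :
    Halts B readWoman s (I.men * 27 + 40) fun s' =>
      Pending B s' rest ∧ ∀ u v, v ≤ w → v ∈ I.manList u →
        s'.arr aRank (I.code (u, v)) = (I.womanList v).idxOf u := by
  have hlm := I.length_womanList_le w
  have hpos := hp.le
  have hhead := hp.reads.head
  unfold Fits at hB
  simp only [womanWords, List.cons_append, List.length_cons] at hpos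
  refine Halts.seq (T₁ := 20) (T₂ := I.men * 27 + 5)
    (R := fun s' => Pending B s' ((I.womanList w).map Fin.val ++ rest) ∧
      s'.reg rLen = (I.womanList w).length) ?_ ?_ (by omega)
  · refine Halts.of_wp ?_ (by decide)
    simp [wp, Expr.eval, hhead]
    exact ⟨by omega, by omega, hp.step (by simp) (by simp)⟩
  · rintro s₁ ⟨h1, h2⟩ hF
    refine (Halts.for_loop (T₁ := 20) (N := (I.womanList w).length) (fun k s' =>
      Pending B s' (((I.womanList w).drop k).map Fin.val ++ rest) ∧
        (∀ u v, v < w → v ∈ I.manList u →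
          s'.arr aRank (I.code (u, v)) = (I.womanList v).idxOf u) ∧
        ∀ u ∈ (I.womanList w).take k, s'.arr aRank (I.code (u, w)) = (I.womanList w).idxOf u)
      h2 (by omega) (by norm_num) rfl rfl ?_ ?_ ?_ ?_).mono le_rfl ?_
    · exact ⟨by simpa using h1, by rw [hF.arr _ rfl]; exact hrank, by simp⟩
    · exact fun k s v h => ⟨h.1.congr rfl rfl, h.2⟩
    · rintro k hk s' hF' hx ⟨h1, h2, h3⟩
      have hw' : s'.reg rOuter = w := by rw [hF'.reg _ rfl, hF.reg _ rfl, hw]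
      rw [List.drop_eq_getElem_cons hk, List.map_cons, List.cons_append] at h1
      have hrow : s'.arr aRow ((I.womanList w)[k]).val = (I.womanList w)[k].val * I.women := by
        rw [hF'.arr _ rfl, hF.arr _ rfl, (hman _).row]
      have hc := I.code_lt ((I.womanList w)[k], w)
      have hpos := h1.le
      have hhead := h1.reads.head
      rw [List.length_cons] at hpos
      refine Halts.of_wp ?_ (by decide)
      have hcode : (I.womanList w)[k].val * I.women + w.val = I.code ((I.womanList w)[k], w) := rfl
      simp [wp, readWomanEntry, Expr.eval, hhead, hrow, hw', hx, hcode, Function.update_apply,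
        I.code_injective.eq_iff, -List.map_drop]
      refine ⟨by omega, by omega, by omega, h1.step (by simp) (by simp), fun u v hv hu => ?_,
        fun u hu => ?_⟩
      · rw [if_neg (fun h => hv.ne h.2), h2 u v hv hu]
      · rw [List.take_add_one, List.getElem?_eq_getElem hk, List.mem_append] at hu
        split_ifs with he
        · rw [he, (I.womanList_nodup w).idxOf_getElem]
        · refine h3 u (hu.resolve_right fun h => he ?_)
          simpa using h
    · have : (I.womanList w).length * (20 + 7) ≤ I.men * 27 := Nat.mul_le_mul_right _ hlm
      omega
    · rintro s' ⟨h1, h2, h3⟩ -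
      refine ⟨by simpa using h1, fun u v hv hu => ?_⟩
      rcases hv.lt_or_eq with hv | rfl
      · exact h2 u v hv hu
      · exact h3 u (by simpa using (I.mutual_acceptable u v).1 hu)

theorem halts_readWomen {B : ℕ} (hB : I.Fits B) {s : State} {rest : List ℕ}
    (hwomen : s.reg rWomen = I.women)
    (hp : Pending B s ((List.finRange I.women).flatMap I.womanWords ++ rest))
    (hman : ∀ u, I.LoadedMan s u) :
    Halts B (forLoop rOuter rWomen readWoman) s (I.women * (I.men * 27 + 47) + 5) fun s' =>
      Pending B s' rest ∧ ∀ u w, w ∈ I.manList u →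
        s'.arr aRank (I.code (u, w)) = (I.womanList w).idxOf u := by
  have hB' := hB
  unfold Fits at hB
  refine (Halts.for_loop (T₁ := I.men * 27 + 40) (N := I.women) (fun k s' =>
    Pending B s' (((List.finRange I.women).drop k).flatMap I.womanWords ++ rest) ∧
      ∀ u (w : Fin I.women), w.val < k → w ∈ I.manList u →
        s'.arr aRank (I.code (u, w)) = (I.womanList w).idxOf u)
    hwomen (by omega) (by norm_num) rfl rfl ?_ ?_ ?_ le_rfl).mono le_rfl ?_
  · exact ⟨by simpa using hp, by simp⟩
  · exact fun k s v h => ⟨h.1.congr rfl rfl, h.2⟩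
  · rintro k hk s' hF hx ⟨h1, h2⟩
    rw [drop_finRange hk, List.flatMap_cons, List.append_assoc] at h1
    refine (halts_readWoman (w := ⟨k, hk⟩) hB' h1 hx (fun u => (hman u).congr ?_ ?_ ?_ ?_)
      (fun u v hv => h2 u v hv)).mono le_rfl ?_
    · exact hF.arr _ rfl
    · rw [hF.arr _ rfl]
    · rw [hF.arr _ rfl]
    · rw [hF.arr _ rfl]
    · rintro s'' ⟨h1, h2⟩ -
      exact ⟨h1, fun u w hw => h2 u w (Nat.lt_succ_iff.1 hw)⟩
  · rintro s' ⟨h1, h2⟩ -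
    exact ⟨by simpa [List.drop_of_length_le] using h1, fun u w => h2 u w w.2⟩

theorem halts_readForbs {B : ℕ} (hB : I.Fits B) {s : State} (hf : s.reg rForb = I.forbidden.length)
    (hp : Pending B s (I.forbidden.flatMap fun e => [e.1.val, e.2.val]))
    (hman : ∀ u, I.LoadedMan s u) (h0 : s.arr aForb = fun _ => 0) :
    Halts B (forLoop rOuter rForb readForb) s (I.numEdges * 27 + 5) fun s' =>
      ∀ e, s'.arr aForb (I.code e) = if e ∈ I.forbiddenSet then 1 else 0 := by
  have hm := I.numEdges_le
  have hl := I.length_forbidden_le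
  unfold Fits at hB
  refine (Halts.for_loop (T₁ := 20) (N := I.forbidden.length) (fun k s' =>
    Pending B s' ((I.forbidden.drop k).flatMap fun e => [e.1.val, e.2.val]) ∧
      ∀ e, s'.arr aForb (I.code e) = if e ∈ I.forbidden.take k then 1 else 0)
    hf (by omega) (by norm_num) rfl rfl ?_ ?_ ?_ ?_).mono le_rfl ?_
  · exact ⟨by simpa using hp, by simp [h0]⟩
  · exact fun k s v h => ⟨h.1.congr rfl rfl, h.2⟩
  · rintro k hk s' hF hx ⟨h1, h2⟩
    rw [List.drop_eq_getElem_cons hk, List.flatMap_cons] at h1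
    obtain ⟨e, he⟩ : ∃ e, e = I.forbidden[k] := ⟨_, rfl⟩
    rw [← he] at h1
    have hrow : s'.arr aRow e.1.val = e.1.val * I.women := by
      rw [hF.arr _ rfl, (hman _).row]
    have hc := I.code_lt e
    have hpos := h1.le
    have hhead := h1.reads.head
    have hsnd := h1.reads.tail.head
    simp only [List.cons_append, List.nil_append, List.length_cons] at hpos
    have hcode : e.1.val * I.women + e.2.val = I.code e := rfl
    refine Halts.of_wp ?_ (by decide)
    simp [wp, readForb, Expr.eval, hhead, hsnd, hrow, hcode, Function.update_apply,
      I.code_injective.eq_iff]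
    refine ⟨by omega, by omega, by omega, ⟨?_, ?_⟩, fun u w => ?_⟩
    · simpa using h1.reads.tail.tail
    · simp only [State.setReg_reg, if_true]
      omega
    · simp only [List.take_add_one, List.getElem?_eq_getElem hk, ← he, List.mem_append]
      by_cases h : (u, w) = e
      · simp [h]
      · simp [h, h2]
  · omega
  · rintro s' ⟨h1, h2⟩ -
    simpa [forbiddenSet] using h2

theorem encode_eq (I : SMInstance) : I.encode =
    I.men :: I.women :: ((List.finRange I.men).flatMap I.manWords ++
      ((List.finRange I.women).flatMap I.womanWords ++
        (I.forbidden.length :: I.forbidden.flatMap fun e => [e.1.val, e.2.val]))) := by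
  unfold manWords womanWords
  simp [encode]

theorem halts_load {B : ℕ} (hB : I.Fits B) :
    Halts B load (initial I.encode) (I.men * (I.women * 27 + 47) + I.women * (I.men * 27 + 47) +
      I.numEdges * 27 + 100) fun s' => I.Loaded s' ∧ s'.reg rBest = I.forbidden.length + 1 ∧
        s'.arr aDigit I.forbidden.length = I.numEdges + 1 ∧
        ∀ i < I.forbidden.length, s'.arr aDigit i = 0 := by
  have hm := I.numEdges_le
  have hlf := I.length_forbidden_le
  have henc := I.encode_eq
  have hB' := hB
  unfold Fits at hB
  have hP : Pending B (State.setReg (initial I.encode) rPos 0) I.encode :=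
    ⟨fun i hi => by simp [initial, hi], by simp; omega⟩
  have hreg : (initial I.encode).reg = fun _ => 0 := rfl
  have hforb : (initial I.encode).arr aForb = fun _ => 0 := rfl
  have hdig₀ : (initial I.encode).arr aDigit = fun _ => 0 := rfl
  generalize initial I.encode = s₀ at hP hreg hforb hdig₀ ⊢
  rw [henc] at hP
  refine Halts.seq (T₁ := 15) (T₂ := I.men * (I.women * 27 + 47) + I.women * (I.men * 27 + 47) +
      I.numEdges * 27 + 85) (R := fun s => s.reg rMen = I.men ∧ s.reg rWomen = I.women ∧
      Pending B s ((List.finRange I.men).flatMap I.manWords ++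
      ((List.finRange I.women).flatMap I.womanWords ++
        (I.forbidden.length :: I.forbidden.flatMap fun e => [e.1.val, e.2.val])))) ?_ ?_ (by omega)
  · refine Halts.of_wp ?_ (by decide)
    have e0 : s₀.arr aIn 0 = I.men := by simpa using hP.reads.head
    have e1 : s₀.arr aIn 1 = I.women := by simpa using hP.reads.tail.head
    simp [wp, Expr.eval, e0, e1]
    refine ⟨by omega, by omega, by omega, ⟨?_, ?_⟩⟩
    · simpa using hP.reads.tail.tail
    · have := hP.le
      simp only [List.length_cons, State.setReg_reg, if_true] at this ⊢
      omega
  rintro s₁ ⟨hmen, hwomen, hp⟩ hF₁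
  refine Halts.seq (T₂ := I.women * (I.men * 27 + 47) + I.numEdges * 27 + 80)
    (halts_readMen hB' hmen hwomen hp (by rw [hF₁.reg _ rfl, hreg])
    (by rw [hF₁.reg _ rfl, hreg])) ?_ (by omega)
  rintro s₂ ⟨hp, hedges, hedge, hman⟩ hF₂
  refine Halts.seq (T₂ := I.numEdges * 27 + 75)
    (halts_readWomen hB' (by rw [hF₂.reg _ rfl, hwomen]) hp hman) ?_ (by omega)
  rintro s₃ ⟨hp, hrank⟩ hF₃
  have hman₃ : ∀ u, I.LoadedMan s₃ u := fun u => (hman u).congr (hF₃.arr _ rfl)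
    (by rw [hF₃.arr _ rfl]) (by rw [hF₃.arr _ rfl]) (by rw [hF₃.arr _ rfl])
  have hdig : s₃.arr aDigit = fun _ => 0 := by
    rw [hF₃.arr _ rfl, hF₂.arr _ rfl, hF₁.arr _ rfl, hdig₀]
  have hedges₃ : s₃.reg rEdges = I.numEdges := by rw [hF₃.reg _ rfl, hedges]
  refine Halts.seq (T₁ := 25) (T₂ := I.numEdges * 27 + 5)
    (R := fun s => Pending B s (I.forbidden.flatMap fun e => [e.1.val, e.2.val]) ∧
      s.reg rForb = I.forbidden.length ∧ s.reg rBest = I.forbidden.length + 1 ∧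
      s.arr aDigit I.forbidden.length = I.numEdges + 1 ∧
      ∀ i < I.forbidden.length, s.arr aDigit i = 0) ?_ ?_ (by omega)
  · have hhead := hp.reads.head
    have hpos := hp.le
    simp only [List.length_cons] at hpos
    refine Halts.of_wp ?_ (by decide)
    simp [wp, Expr.eval, hhead, hdig, hedges₃, Function.update_apply]
    exact ⟨by omega, by omega, by omega, by omega, by omega, hp.step (by simp) (by simp),
      fun i hi => by omega⟩
  rintro s₄ ⟨hp, hforb₄, hbest, hL, hd⟩ hF₄
  have hman₄ : ∀ u, I.LoadedMan s₄ u := fun u => (hman₃ u).congr (hF₄.arr _ rfl)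
    (by rw [hF₄.arr _ rfl]) (by rw [hF₄.arr _ rfl]) (by rw [hF₄.arr _ rfl])
  refine (halts_readForbs hB' hforb₄ hp hman₄ ?_).mono le_rfl ?_
  · rw [hF₄.arr _ rfl, hF₃.arr _ rfl, hF₂.arr _ rfl, hF₁.arr _ rfl, hforb]
  rintro s₅ hfb hF₅
  refine ⟨⟨?_, ?_, ?_, ?_, fun u => (hman₄ u).congr (hF₅.arr _ rfl)
    (by rw [hF₅.arr _ rfl]) (by rw [hF₅.arr _ rfl]) (by rw [hF₅.arr _ rfl]), ?_, hfb, ?_⟩,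
    ?_, ?_, ?_⟩
  · rw [hF₅.reg _ rfl, hF₄.reg _ rfl, hF₃.reg _ rfl, hF₂.reg _ rfl, hmen]
  · rw [hF₅.reg _ rfl, hF₄.reg _ rfl, hF₃.reg _ rfl, hF₂.reg _ rfl, hwomen]
  · rw [hF₅.reg _ rfl, hforb₄]
  · rw [hF₅.reg _ rfl, hF₄.reg _ rfl, hedges₃]
  · rw [hF₅.arr _ rfl, hF₄.arr _ rfl]; exact hrank
  · rw [hF₅.arr _ rfl, hF₄.arr _ rfl, hF₃.arr _ rfl]; exact hedge
  · rw [hF₅.reg _ rfl, hbest]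
  · rw [hF₅.arr _ rfl, hL]
  · rw [hF₅.arr _ rfl]; exact hd

end SMInstance

/-! ### Deferred acceptance on the machine -/

namespace RAM

open RAM.Expr in
/-- Everybody is free. -/
def initDA : Prog :=
  forLoop rOuter rMen
    (.put aPtr (reg rOuter) (lit 0) ⨾ .put aStack (reg rOuter) (reg rOuter)) ⨾
  forLoop rOuter rWomen
    (.put aCur (reg rOuter) (lit 0) ⨾ .put aBest (reg rOuter) (reg rMen)) ⨾
  .assign rTop (reg rMen)

open RAM.Expr in
/-- The current woman accepts the current man's proposal. -/
def accept : Prog :=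
  (.assign rOld (get aCur (reg rWoman)) ⨾ .put aBest (reg rWoman) (get aRank (reg rCode)) ⨾
    .branch (.eq (get aForb (reg rCode)) (lit 0))
      (.put aCur (reg rWoman) (add (reg rMan) (lit 1)) ⨾ .assign rTop (sub (reg rTop) (lit 1)))
      (.put aCur (reg rWoman) (lit 0))) ⨾
  .branch (.eq (reg rOld) (lit 0)) .skip
    (.put aStack (reg rTop) (sub (reg rOld) (lit 1)) ⨾ .assign rTop (add (reg rTop) (lit 1)))

open RAM.Expr in
/-- The man on top of the stack deals with the next entry of his list. -/
def stepDA : Prog :=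
  .assign rMan (get aStack (sub (reg rTop) (lit 1))) ⨾
  .branch (.lt (get aPtr (reg rMan)) (get aLen (reg rMan)))
    ((.assign rWoman (get aIn (add (get aStart (reg rMan)) (get aPtr (reg rMan)))) ⨾
      .put aPtr (reg rMan) (add (get aPtr (reg rMan)) (lit 1)) ⨾
      .assign rCode (add (get aRow (reg rMan)) (reg rWoman))) ⨾
      .branch (.eq (get aDel (reg rCode)) (lit 0))
        (.branch (.lt (get aRank (reg rCode)) (get aBest (reg rWoman))) accept .skip) .skip)
    (.assign rTop (sub (reg rTop) (lit 1)))

open RAM.Expr in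
/-- Does no woman wait for someone better than a forbidden partner? -/
def checkDA : Prog :=
  .assign rOk (lit 1) ⨾
  forLoop rOuter rWomen
    (.branch (.eq (get aCur (reg rOuter)) (lit 0))
      (.branch (.lt (get aBest (reg rOuter)) (reg rMen)) (.assign rOk (lit 0)) .skip) .skip)

open RAM.Expr in
/-- Deferred acceptance. -/
def runDA : Prog := initDA ⨾ .loop (.lt (lit 0) (reg rTop)) stepDA ⨾ checkDA

open RAM.Expr in
/-- Write the matching to the output array. -/
def store : Prog :=
  forLoop rOuter rMen (.put aOut (reg rOuter) (lit 0)) ⨾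
  forLoop rOuter rWomen
    (.branch (.eq (get aCur (reg rOuter)) (lit 0)) .skip
      (.put aOut (sub (get aCur (reg rOuter)) (lit 1)) (add (reg rOuter) (lit 1))))

/-- `0` stands for nobody and `i + 1` for `i`. -/
def optCode {n : ℕ} (o : Option (Fin n)) : ℕ := o.elim 0 fun i => i.val + 1

end RAM

/-! ### Deferred acceptance on the machine: correctness and step count -/

namespace SMInstance

open RAM

variable {I : SMInstance}

/-- The machine represents the state `g` of deferred acceptance. -/
structure Rep (g : I.DAState) (s : State) : Prop where
  ptr : ∀ u : Fin I.men, s.arr aPtr u.val = g.ptr u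
  cur : ∀ w : Fin I.women, s.arr aCur w.val = optCode (g.cur w)
  best : ∀ w : Fin I.women, s.arr aBest w.val = g.best w
  top : s.reg rTop = g.stack.length
  stack : Reads (s.arr aStack) 0 (g.stack.map Fin.val)

/-- The set `D` is marked as deleted. -/
def Marked (D : Finset I.Pair) (s : State) : Prop :=
  ∀ e, s.arr aDel (I.code e) = if e ∈ D then 1 else 0

/-- A potential which drops in each step of deferred acceptance. -/
def DAState.potential (g : I.DAState) : ℕ :=
  2 * ∑ u, ((I.manList u).length - g.ptr u) + g.stack.length

theorem sum_length_manList : ∑ u, (I.manList u).length = I.numEdges := by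
  rw [← length_edgeList, Fin.sum_univ_def, edgeList, List.length_flatMap]
  simp

theorem DAState.potential_start : (DAState.start I).potential = 2 * I.numEdges + I.men := by
  simp [potential, start, sum_length_manList]

theorem DAState.potential_skip {g : I.DAState} {x : Fin I.men}
    (hx : g.ptr x < (I.manList x).length) : (g.skip x).potential + 2 = g.potential := by
  have h : ∑ u, ((I.manList u).length - (g.skip x).ptr u) + 1 =
      ∑ u, ((I.manList u).length - g.ptr u) := by
    rw [← Finset.add_sum_erase _ _ (Finset.mem_univ x), ← Finset.add_sum_erase (Finset.univ)
      (fun u => (I.manList u).length - g.ptr u) (Finset.mem_univ x),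
      Finset.sum_congr rfl (g := fun u => (I.manList u).length - g.ptr u)]
    · simp only [skip, Function.update_self]
      omega
    · intro u hu
      simp [skip, Finset.ne_of_mem_erase hu]
  have h' : (g.skip x).stack = g.stack := rfl
  unfold potential
  rw [h']
  omega

/-- At most one displaced man returns to the stack. List entries have weight 2 in the potential so
that the drop in `potential_skip` pays for him. -/
theorem DAState.potential_take_le {g : I.DAState} {w : Fin I.women} {r : ℕ}
    {o : Option (Fin I.men)} {st : List (Fin I.men)} (h : st.length ≤ g.stack.length) :
    (g.take w r o st).potential ≤ g.potential + 1 := by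
  have : (g.cur w).toList.length ≤ 1 := by cases g.cur w <;> simp
  simp only [potential, take, List.length_append]
  omega

theorem DAState.Inv.length_stack_le {D : Finset I.Pair} {g : I.DAState} (h : g.Inv D) :
    g.stack.length ≤ I.men := by
  simpa using h.nodup.length_le_card

theorem halts_initDA {B : ℕ} (hB : I.Fits B) {s : State} (hL : I.Loaded s) :
    Halts B initDA s ((I.men + I.women) * 27 + 20) (Rep (DAState.start I)) := by
  unfold Fits at hB
  refine Halts.seq (T₁ := I.men * 27 + 5) (T₂ := I.women * 27 + 15)
    (R := fun s' => (∀ u : Fin I.men, s'.arr aPtr u.val = 0) ∧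
      Reads (s'.arr aStack) 0 ((List.finRange I.men).map Fin.val)) ?_ ?_ (by omega)
  · refine (Halts.for_loop (T₁ := 20) (N := I.men) (fun k s' =>
      (∀ i < k, s'.arr aPtr i = 0) ∧ ∀ i < k, s'.arr aStack i = i)
      hL.men (by omega) (by norm_num) rfl rfl (by simp) (fun k s v h => h) ?_ le_rfl).mono
        le_rfl ?_
    · rintro k hk s' hF hx ⟨h1, h2⟩
      refine Halts.of_wp ?_ (by decide)
      simp [wp, Expr.eval, hx, Function.update_apply]
      refine ⟨by omega, fun i hi hne => h1 i (by omega), fun i hi => ?_⟩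
      split_ifs with hne
      · exact hne.symm
      · exact h2 i (by omega)
    · rintro s' ⟨h1, h2⟩ -
      exact ⟨fun u => h1 u u.2, fun i hi => by simpa using h2 i (by simpa using hi)⟩
  rintro s₁ ⟨h1, h2⟩ hF₁
  refine Halts.seq (T₁ := I.women * 27 + 5) (T₂ := 10)
    (R := fun s' => (∀ w : Fin I.women, s'.arr aCur w.val = 0) ∧
      (∀ w : Fin I.women, s'.arr aBest w.val = I.men)) ?_ ?_ (by omega)
  · refine (Halts.for_loop (T₁ := 20) (N := I.women) (fun k s' =>
      (∀ i < k, s'.arr aCur i = 0) ∧ ∀ i < k, s'.arr aBest i = I.men)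
      (by rw [hF₁.reg _ rfl, hL.women]) (by omega) (by norm_num) rfl rfl (by simp)
      (fun k s v h => h) ?_ le_rfl).mono le_rfl ?_
    · rintro k hk s' hF hx ⟨h1, h2⟩
      have hm : s'.reg rMen = I.men := by rw [hF.reg _ rfl, hF₁.reg _ rfl, hL.men]
      refine Halts.of_wp ?_ (by decide)
      simp [wp, Expr.eval, hx, Function.update_apply, hm]
      refine ⟨by omega, by omega, fun i hi hne => h1 i (by omega),
        fun i hi hne => h2 i (by omega)⟩
    · rintro s' ⟨h1, h2⟩ -
      exact ⟨fun u => h1 u u.2, fun u => h2 u u.2⟩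
  rintro s₂ ⟨h3, h4⟩ hF₂
  have hm : s₂.reg rMen = I.men := by rw [hF₂.reg _ rfl, hF₁.reg _ rfl, hL.men]
  refine Halts.of_wp ⟨by simp only [Expr.eval, hm]; omega, ?_⟩ (by decide)
  refine ⟨fun u => ?_, fun w => ?_, fun w => ?_, ?_, ?_⟩
  · simp [hF₂.arr aPtr rfl, h1, DAState.start]
  · simp [h3, DAState.start, optCode]
  · simp [h4, DAState.start]
  · simp [Expr.eval, hm, DAState.start]
  · simpa [hF₂.arr aStack rfl, DAState.start] using h2

theorem halts_accept {B : ℕ} (hB : I.Fits B) {s : State} (hL : I.Loaded s) {g : I.DAState}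
    (hg : Rep g s) {x : Fin I.men} {w : Fin I.women} {st : List (Fin I.men)}
    (hx : s.reg rMan = x) (hw : s.reg rWoman = w) (hc : s.reg rCode = I.code (x, w))
    (hxw : w ∈ I.manList x) (hs : g.stack = st ++ [x]) (hlen : g.stack.length ≤ I.men) :
    Halts B accept s 100 fun s' => ∃ o st', Rep (g.take w ((I.womanList w).idxOf x) o st') s' ∧
      st'.length ≤ g.stack.length ∧
      ((x, w) ∈ I.forbiddenSet ∧ o = none ∧ st' = st ++ [x] ∨
        (x, w) ∉ I.forbiddenSet ∧ o = some x ∧ st' = st) := by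
  have hrank := hL.rank x w hxw
  have hforb := hL.forbidden (x, w)
  have hidx := List.idxOf_lt_length_of_mem ((I.mutual_acceptable x w).1 hxw)
  have hll := I.length_womanList_le w
  have hcur := hg.cur w
  have htop := hg.top
  have hstack := hg.stack
  have hst : g.stack.length = st.length + 1 := by simp [hs]
  have hold : optCode (g.cur w) ≤ I.men := by
    cases g.cur w with
    | none => simp [optCode]
    | some y => have := y.2; simp [optCode]
  have hw2 := w.2
  have hx2 := x.2
  unfold Fits at hB
  -- At this midpoint the proposal has been recorded, but the displaced man is only in `rOld` and
  -- not yet on the stack.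
  refine Halts.seq (T₁ := 60) (T₂ := 40) (R := fun s' => s'.reg rOld = optCode (g.cur w) ∧
    ∃ o st', st'.length ≤ g.stack.length ∧ Rep { g with
      cur := Function.update g.cur w o
      best := Function.update g.best w ((I.womanList w).idxOf x)
      stack := st' } s' ∧
    ((x, w) ∈ I.forbiddenSet ∧ o = none ∧ st' = st ++ [x] ∨
        (x, w) ∉ I.forbiddenSet ∧ o = some x ∧ st' = st)) ?_ ?_ le_rfl
  · refine Halts.of_wp ?_ (by decide)
    by_cases hf : (x, w) ∈ I.forbiddenSet
    · simp [wp, Expr.eval, Test.Holds, hx, hw, hc, hrank, hforb, hf, hcur]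
      refine ⟨by omega, by omega, by omega, by omega, by omega, ?_, fun v => ?_, fun v => ?_, ?_, ?_⟩
      · simpa using hg.ptr
      · by_cases hv : v = w
        · subst hv; simp [optCode]
        · simp [hv, Fin.val_inj, hg.cur]
      · by_cases hv : v = w
        · subst hv; simp
        · simp [hv, Fin.val_inj, hg.best]
      · simp [htop, hs]
      · simpa [hs] using hstack
    · simp [wp, Expr.eval, Test.Holds, hx, hw, hc, hrank, hforb, hf, hcur]
      refine ⟨by omega, by omega, by omega, by omega, by omega, by omega, by omega, ?_,
        fun v => ?_, fun v => ?_, ?_, ?_⟩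
      · simpa using hg.ptr
      · by_cases hv : v = w
        · subst hv; simp [optCode]
        · simp [hv, Fin.val_inj, hg.cur]
      · by_cases hv : v = w
        · subst hv; simp
        · simp [hv, Fin.val_inj, hg.best]
      · simp [htop, hs]
      · rw [hs, List.map_append] at hstack
        simpa using hstack.left
  rintro s₁ ⟨h1, o, st', h2, h3, h4⟩ -
  refine Halts.of_wp ?_ (by decide)
  have htop' : s₁.reg rTop = st'.length := h3.top
  rcases hco : g.cur w with _ | y
  · rw [hco] at h1
    simp [wp, Expr.eval, Test.Holds, h1, optCode]
    refine ⟨o, st', ⟨h3.ptr, h3.cur, h3.best, ?_, ?_⟩, h2, h4⟩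
    · simpa [DAState.take, hco] using htop'
    · simpa [DAState.take, hco] using h3.stack
  · rw [hco] at h1
    have hy := y.2
    simp [wp, Expr.eval, Test.Holds, h1, optCode]
    refine ⟨by omega, by omega, by omega, o, st', ⟨?_, ?_, ?_, ?_, ?_⟩, h2, h4⟩
    · simpa [DAState.take] using h3.ptr
    · simpa [DAState.take] using h3.cur
    · simpa [DAState.take] using h3.best
    · simpa [DAState.take, hco] using htop'
    · have := h3.stack.snoc (v := y.val) (i := s₁.reg rTop) (by simp [htop'])
      simpa [DAState.take, hco] using this

/-- The branches of the program realise the transitions of `Inv.pop`, `Inv.skip` and `Inv.take`,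
which lower the potential by 1, by 2 and by at least 1. -/
theorem halts_stepDA {B : ℕ} (hB : I.Fits B) {s : State} (hL : I.Loaded s) {D : Finset I.Pair}
    (hD : Marked D s) {g : I.DAState} (hI : g.Inv D) (hg : Rep g s) (hne : 0 < s.reg rTop) :
    Halts B stepDA s 200 fun s' => ∃ g' : I.DAState, g'.Inv D ∧ Rep g' s' ∧
      g'.potential < g.potential := by
  have htop := hg.top
  have hlen := hI.length_stack_le
  obtain ⟨st, x, hs⟩ : ∃ st x, g.stack = st ++ [x] := by
    rcases List.eq_nil_or_concat g.stack with h | ⟨st, x, h⟩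
    · simp [h] at htop; omega
    · exact ⟨st, x, by simpa using h⟩
  have hstl : g.stack.length = st.length + 1 := by simp [hs]
  have hxs : x ∈ g.stack := by simp [hs]
  have hx : s.arr aStack (s.reg rTop - 1) = x := by
    have := hg.stack st.length (by simp [hs])
    rw [htop, hstl, Nat.add_sub_cancel]
    simpa [hs] using this
  have hx2 := x.2
  have hB' := hB
  have hlw := I.length_manList_le x
  unfold Fits at hB
  refine Halts.seq (T₁ := 6) (T₂ := 190) (R := fun s' => s'.reg rMan = x)
    (Halts.of_wp ?_ (by decide)) ?_ (by omega)
  · simp [wp, Expr.eval, hx]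
    omega
  intro s₁ hx₁ hF₁
  have hL₁ : I.Loaded s₁ := hL.congr
    (fun y hy => hF₁.reg y (by simp [Prog.writesReg]; omega))
    (fun y _ _ => hF₁.arr y (by simp [Prog.writesArr]))
  have hg₁ : Rep g s₁ := by
    refine ⟨?_, ?_, ?_, ?_, ?_⟩
    · rw [hF₁.arr _ rfl]; exact hg.ptr
    · rw [hF₁.arr _ rfl]; exact hg.cur
    · rw [hF₁.arr _ rfl]; exact hg.best
    · rw [hF₁.reg _ rfl]; exact hg.top
    · rw [hF₁.arr _ rfl]; exact hg.stack
  have hD₁ : Marked D s₁ := by unfold Marked; rw [hF₁.arr _ rfl]; exact hD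
  clear hF₁ hL hg hD hx
  have hptr := hg₁.ptr x
  have hlen₁ := (hL₁.man x).len
  refine Halts.branch (T₁ := 180) (fun hb => ?_) (fun hb => ?_) (by decide)
  · simp only [Test.Holds, Expr.eval, hx₁, hptr, hlen₁] at hb
    obtain ⟨w, hwdef⟩ : ∃ w, w = (I.manList x)[g.ptr x] := ⟨_, rfl⟩
    have hw : w ∈ I.manList x := hwdef ▸ List.getElem_mem _
    have hidx : (I.manList x).idxOf w = g.ptr x := by
      rw [hwdef, (I.manList_nodup x).idxOf_getElem]
    have hin : s₁.arr aIn (s₁.arr aStart x.val + g.ptr x) = w := by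
      have := (hL₁.man x).list (g.ptr x) (by simpa using hb)
      simpa [hwdef] using this
    have hw2 := w.2
    have hcl := I.code_lt (x, w)
    have hcode : x.val * I.women + w.val = I.code (x, w) := rfl
    refine Halts.seq (T₁ := 30) (T₂ := 150) (R := fun s' => Rep (g.skip x) s' ∧
      s'.reg rWoman = w ∧ s'.reg rCode = I.code (x, w)) (Halts.of_wp ?_ (by decide)) ?_ (by omega)
    · simp [wp, Expr.eval, hx₁, hptr, hin, (hL₁.man x).row, hcode]
      refine ⟨by omega, by omega, by omega, by omega, fun u => ?_, fun v => ?_, fun v => ?_, ?_, ?_⟩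
      · by_cases hu : u = x
        · subst hu; simp [DAState.skip]
        · simp [DAState.skip, hu, Fin.val_inj, hg₁.ptr]
      · simpa [DAState.skip] using hg₁.cur v
      · simpa [DAState.skip] using hg₁.best v
      · simpa [DAState.skip] using hg₁.top
      · simpa [DAState.skip] using hg₁.stack
    rintro s₂ ⟨hg₂, hw₂, hc₂⟩ hF₂
    have hx₂ : s₂.reg rMan = x := by rw [hF₂.reg _ rfl, hx₁]
    have hL₂ : I.Loaded s₂ := hL₁.congr
      (fun y hy => hF₂.reg y (by simp [Prog.writesReg]; omega))
      (fun y hy _ => hF₂.arr y (by simp [Prog.writesArr]; omega))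
    have hD₂ : Marked D s₂ := by unfold Marked; rw [hF₂.arr _ rfl]; exact hD₁
    have hpot := DAState.potential_skip hb
    have hdel := hD₂ (x, w)
    have hrank := hL₂.rank x w hw
    have hbest : s₂.arr aBest w.val = g.best w := hg₂.best w
    refine Halts.branch (T₁ := 140) (fun hb => ?_) (fun hb => ?_) (by decide)
    · have hdx : (x, w) ∉ D := by
        intro h
        simp [Test.Holds, Expr.eval, hc₂, hdel, h] at hb
      refine Halts.branch (T₁ := 120) (fun hb => ?_) (fun hb => ?_) (by decide)
      · simp only [Test.Holds, Expr.eval, hc₂, hw₂, hrank, hbest] at hb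
        refine (halts_accept hB' hL₂ hg₂ hx₂ hw₂ hc₂ hw hs hlen).mono (by norm_num) ?_
        rintro s' ⟨o, st', h1, h2, h3⟩ -
        refine ⟨_, hI.take hs hw hidx hdx hb h3, h1, ?_⟩
        have := DAState.potential_take_le (w := w) (r := (I.womanList w).idxOf x) (o := o) h2
        omega
      · simp only [Test.Holds, Expr.eval, hc₂, hw₂, hrank, hbest, not_lt] at hb
        exact Halts.of_wp ⟨_, hI.skip hxs hw hidx (.inr hb), hg₂, by omega⟩ (by decide)
    · have hdx : (x, w) ∈ D := by
        by_contra h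
        simp [Test.Holds, Expr.eval, hc₂, hdel, h] at hb
      exact Halts.of_wp ⟨_, hI.skip hxs hw hidx (.inl hdx), hg₂, by omega⟩ (by decide)
  · simp only [Test.Holds, Expr.eval, hx₁, hptr, hlen₁, not_lt] at hb
    have htop₁ := hg₁.top
    refine Halts.of_wp ?_ (by decide)
    simp [wp, Expr.eval]
    refine ⟨by omega, _, hI.pop hs (le_antisymm (hI.ptr_le x) hb), ⟨?_, ?_, ?_, ?_, ?_⟩, ?_⟩
    · simpa using hg₁.ptr
    · simpa using hg₁.cur
    · simpa using hg₁.best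
    · simp [htop₁, hstl]
    · have := hg₁.stack
      rw [hs, List.map_append] at this
      simpa using this.left
    · simp only [DAState.potential]
      omega

theorem halts_checkDA {B : ℕ} (hB : I.Fits B) {s : State} (hL : I.Loaded s) {g : I.DAState}
    (hg : Rep g s) : Halts B checkDA s (I.women * 27 + 10) fun s' =>
      (s'.reg rOk = 1 ∧ ∀ w, g.cur w = none → I.men ≤ g.best w) ∨
      (s'.reg rOk = 0 ∧ ∃ w, g.cur w = none ∧ g.best w < I.men) := by
  unfold Fits at hB
  refine Halts.seq (T₁ := 2) (T₂ := I.women * 27 + 5) (R := fun s' => s'.reg rOk = 1)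
    (Halts.of_wp (by simp [wp, Expr.eval]; omega) (by decide)) ?_ (by omega)
  intro s₁ hok hF₁
  refine (Halts.for_loop (T₁ := 20) (N := I.women) (fun k s' =>
      (s'.reg rOk = 1 ∧ ∀ w : Fin I.women, w.val < k → g.cur w = none → I.men ≤ g.best w) ∨
      (s'.reg rOk = 0 ∧ ∃ w, g.cur w = none ∧ g.best w < I.men))
      (by rw [hF₁.reg _ rfl, hL.women]) (by omega) (by norm_num) rfl rfl (by simp [hok])
      (fun k s v h => by simpa using h) ?_ le_rfl).mono le_rfl ?_
  · intro k hk s' hF hx h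
    have hm : s'.reg rMen = I.men := by rw [hF.reg _ rfl, hF₁.reg _ rfl, hL.men]
    have hcur : s'.arr aCur k = optCode (g.cur ⟨k, hk⟩) := by
      rw [hF.arr _ rfl, hF₁.arr _ rfl]; exact hg.cur ⟨k, hk⟩
    have hbest : s'.arr aBest k = g.best ⟨k, hk⟩ := by
      rw [hF.arr _ rfl, hF₁.arr _ rfl]; exact hg.best ⟨k, hk⟩
    refine Halts.of_wp ?_ (by decide)
    have hstep : (g.cur ⟨k, hk⟩ = none → I.men ≤ g.best ⟨k, hk⟩) →
        (s'.reg rOk = 1 ∧ ∀ w : Fin I.women, w.val < k + 1 → g.cur w = none → I.men ≤ g.best w) ∨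
        (s'.reg rOk = 0 ∧ ∃ w, g.cur w = none ∧ g.best w < I.men) := by
      intro h'
      refine h.imp (fun h => ⟨h.1, fun w hw hc => ?_⟩) id
      rcases Nat.lt_succ_iff_lt_or_eq.1 hw with hlt | rfl
      · exact h.2 w hlt hc
      · exact h' hc
    rcases hc : g.cur ⟨k, hk⟩ with _ | y
    · by_cases hb : g.best ⟨k, hk⟩ < I.men
      · simp [wp, Expr.eval, Test.Holds, hx, hcur, hbest, hc, hm, hb, optCode]
        exact ⟨_, hc, hb⟩
      · simp only [wp, Expr.eval, Test.Holds, hx, hcur, hbest, hc, hm, hb, optCode]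
        exact ⟨fun _ => ⟨fun h => h.elim, fun _ => hstep fun _ => not_lt.1 hb⟩,
          fun h => absurd rfl h⟩
    · simp only [wp, Expr.eval, Test.Holds, hx, hcur, hc, hm, optCode]
      exact ⟨fun h => absurd h (by simp), fun _ => hstep fun h => by simp [hc] at h⟩
  · rintro s' h -
    exact h.imp (fun h => ⟨h.1, fun w => h.2 w w.2⟩) id

/-- The initial potential `2 * m + men` bounds the number of rounds. Failure also reports that `D`
misses a forbidden edge; this is what guarantees that deleting all of `P` succeeds, with no separate
existence theorem for stable matchings. -/
theorem halts_runDA {B : ℕ} (hB : I.Fits B) {s : State} (hL : I.Loaded s) {D : Finset I.Pair}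
    (hD : Marked D s) :
    Halts B runDA s ((2 * I.numEdges + I.men) * 210 + (I.men + I.women) * 54 + 50) fun s' =>
      (s'.reg rOk = 1 ∧ ∃ g : I.DAState, I.StableWithout D g.matching ∧ Rep g s') ∨
      (s'.reg rOk = 0 ∧ (∀ M, ¬ I.StableWithout D M) ∧ ¬ I.forbiddenSet ⊆ D) := by
  refine Halts.seq (T₂ := (2 * I.numEdges + I.men) * 210 + I.women * 27 + 30)
    (halts_initDA hB hL) ?_ (by omega)
  intro s₁ hg₁ hF₁
  have hL₁ : I.Loaded s₁ := hL.congr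
    (fun y hy => hF₁.reg y (by simp [initDA, forLoop, Prog.writesReg]; omega))
    (fun y hy _ => hF₁.arr y (by simp [initDA, forLoop, Prog.writesArr]; omega))
  have hD₁ : Marked D s₁ := by unfold Marked; rw [hF₁.arr _ rfl]; exact hD
  refine Halts.seq (T₁ := (2 * I.numEdges + I.men) * 210 + 10) (T₂ := I.women * 27 + 20)
    (R := fun s' => ∃ g : I.DAState, g.Inv D ∧ Rep g s' ∧ g.stack = []) ?_ ?_ (by omega)
  · refine (Halts.loop (T₁ := 200) (b := .lt (.lit 0) (.reg rTop))
      (fun k s' => ∃ g : I.DAState, g.Inv D ∧ Rep g s' ∧ g.potential = k)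
      ⟨_, DAState.start_inv D, hg₁, DAState.potential_start⟩ ?_ ?_).mono le_rfl ?_
    · rintro k s' hF ⟨g, hI, hg, rfl⟩ hb
      refine (halts_stepDA hB (hL₁.congr (fun y hy => hF.reg y ?_) (fun y hy _ => hF.arr y ?_))
        ?_ hI hg hb).mono le_rfl ?_
      · simp [stepDA, accept, Prog.writesReg]; omega
      · simp [stepDA, accept, Prog.writesArr]; omega
      · unfold Marked; rw [hF.arr _ rfl]; exact hD₁
      · rintro s'' ⟨g', h1, h2, h3⟩ -
        exact ⟨_, h3, g', h1, h2, rfl⟩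
    · simp only [Test.cost, Expr.cost]
      omega
    · rintro s' ⟨⟨k, g, h1, h2, h3⟩, h4⟩ -
      refine ⟨g, h1, h2, ?_⟩
      have := h2.top
      simp only [Test.Holds, Expr.eval] at h4
      exact List.length_eq_zero_iff.1 (by omega)
  rintro s₂ ⟨g, hI, hg, hs⟩ hF₂
  have hL₂ : I.Loaded s₂ := hL₁.congr
    (fun y hy => hF₂.reg y (by simp [stepDA, accept, Prog.writesReg]; omega))
    (fun y hy _ => hF₂.arr y (by simp [stepDA, accept, Prog.writesArr]; omega))
  refine (halts_checkDA hB hL₂ hg).mono (by omega) ?_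
  rintro s₃ (⟨h1, h2⟩ | ⟨h1, w, h2, h3⟩) hF₃
  · refine .inl ⟨h1, g, hI.stable_matching hs h2, ⟨?_, ?_, ?_, ?_, ?_⟩⟩
    · rw [hF₃.arr _ rfl]; exact hg.ptr
    · rw [hF₃.arr _ rfl]; exact hg.cur
    · rw [hF₃.arr _ rfl]; exact hg.best
    · rw [hF₃.reg _ rfl]; exact hg.top
    · rw [hF₃.arr _ rfl]; exact hg.stack
  · refine .inr ⟨h1, hI.not_stable hs h2 h3, fun h => ?_⟩
    have := hI.le_best_of_subset h w h2
    omega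

/-- The output is indexed by men but written woman by woman; `man_unique` ensures that no cell is
overwritten by a second woman. -/
theorem halts_store {B : ℕ} (hB : I.Fits B) {s : State} (hL : I.Loaded s) {g : I.DAState}
    (hg : Rep g s) (hM : I.IsMatching g.matching) :
    Halts B store s ((I.men + I.women) * 27 + 10) fun s' => I.Outputs s' g.matching := by
  unfold Fits at hB
  refine Halts.seq (T₁ := I.men * 27 + 5) (T₂ := I.women * 27 + 5)
    (R := fun s' => ∀ u : Fin I.men, s'.arr aOut u.val = 0) ?_ ?_ (by omega)
  · refine (Halts.for_loop (T₁ := 20) (N := I.men) (fun k s' => ∀ i < k, s'.arr aOut i = 0)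
      hL.men (by omega) (by norm_num) rfl rfl (by simp) (fun k s v h => h) ?_ le_rfl).mono
        le_rfl ?_
    · rintro k hk s' hF hx h1
      refine Halts.of_wp ?_ (by decide)
      simp [wp, Expr.eval, hx, Function.update_apply]
      refine ⟨by omega, fun i hi hne => h1 i (by omega)⟩
    · rintro s' h1 -
      exact fun u => h1 u u.2
  intro s₁ h0 hF₁
  refine (Halts.for_loop (T₁ := 20) (N := I.women) (fun k s' =>
      (∀ (u : Fin I.men) (w : Fin I.women), w.val < k → g.cur w = some u →
        s'.arr aOut u.val = w.val + 1) ∧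
      (∀ u : Fin I.men, (∀ w : Fin I.women, w.val < k → g.cur w ≠ some u) → s'.arr aOut u.val = 0))
      (by rw [hF₁.reg _ rfl, hL.women]) (by omega) (by norm_num) rfl rfl (by simp [h0])
      (fun k s v h => h) ?_ le_rfl).mono le_rfl ?_
  · rintro k hk s' hF hx ⟨h1, h2⟩
    have hcur : s'.arr aCur k = optCode (g.cur ⟨k, hk⟩) := by
      rw [hF.arr _ rfl, hF₁.arr _ rfl]; exact hg.cur ⟨k, hk⟩
    refine Halts.of_wp ?_ (by decide)
    rcases hc : g.cur ⟨k, hk⟩ with _ | y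
    · simp only [wp, Expr.eval, Test.Holds, hx, hcur, hc, optCode]
      refine ⟨fun _ => ⟨fun u w hw hcw => ?_, fun u hu => h2 u fun w hw => hu w (by omega)⟩,
        fun h => absurd rfl h⟩
      rcases Nat.lt_succ_iff_lt_or_eq.1 hw with hlt | rfl
      · exact h1 u w hlt hcw
      · simp [hc] at hcw
    · have hy := y.2
      simp [wp, Expr.eval, Test.Holds, hx, hcur, hc, optCode, Function.update_apply, Fin.val_inj]
      refine ⟨by omega, by omega, fun u w hw hcw => ?_, fun u hu => ?_⟩
      · by_cases hu : u = y
        · subst hu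
          have := hM.man_unique _ (DAState.mem_matching.2 hcw) _ (DAState.mem_matching.2 hc) rfl
          simp only [Prod.mk.injEq, true_and] at this
          simp [this]
        · rw [if_neg hu]
          rcases Nat.lt_or_eq_of_le hw with hlt | rfl
          · exact h1 u w hlt hcw
          · exact absurd (Option.some.inj (hcw.symm.trans hc)) hu
      · have : u ≠ y := by
          rintro rfl
          exact hu ⟨k, hk⟩ (by simp) hc
        rw [if_neg this]
        exact h2 u fun w hw => hu w (by omega)
  · rintro s' ⟨h1, h2⟩ -
    exact ⟨fun u w h => h1 u w w.2 (DAState.mem_matching.1 h),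
      fun u h => h2 u fun w _ hc => h w (DAState.mem_matching.2 hc)⟩

end SMInstance

/-! ### The main loop -/

namespace RAM

open RAM.Expr in
/-- Mark the edges whose numbers are the digits, and count the nonzero digits. -/
def mark : Prog :=
  .assign rCount (lit 0) ⨾
  forLoop rOuter rForb
    (.branch (.eq (get aDigit (reg rOuter)) (lit 0)) .skip
      (.put aDel (get aEdge (get aDigit (reg rOuter))) (lit 1) ⨾
        .assign rCount (add (reg rCount) (lit 1))))

open RAM.Expr in
/-- Remove the marks. -/
def unmark : Prog :=
  forLoop rOuter rForb
    (.branch (.eq (get aDigit (reg rOuter)) (lit 0)) .skip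
      (.put aDel (get aEdge (get aDigit (reg rOuter))) (lit 0)))

open RAM.Expr in
/-- Go on to the next sequence of digits. -/
def nextDigits : Prog :=
  .assign rInner (lit 0) ⨾
  .loop (.eq (get aDigit (reg rInner)) (reg rEdges))
    (.put aDigit (reg rInner) (lit 0) ⨾ .assign rInner (add (reg rInner) (lit 1))) ⨾
  .branch (.lt (reg rInner) (reg rForb))
    (.put aDigit (reg rInner) (add (get aDigit (reg rInner)) (lit 1))) (.assign rDone (lit 1))

open RAM.Expr in
/-- Keep the matching found if it is the best so far. -/
def keepBest : Prog :=
  .branch (.eq (reg rOk) (lit 1))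
    (.branch (.lt (reg rCount) (reg rBest)) (.assign rBest (reg rCount) ⨾ store) .skip) .skip

/-- Deal with one sequence of digits. -/
def tryDigits : Prog := mark ⨾ runDA ⨾ keepBest ⨾ unmark ⨾ nextDigits

open RAM.Expr in
/-- The whole program. -/
def solve : Prog := load ⨾ .loop (.eq (reg rDone) (lit 0)) tryDigits

end RAM

/-! ### The enumeration of deleted sets: correctness and step count -/

namespace SMInstance

open RAM

variable {I : SMInstance}

/-- The machine holds the digits of `k`, followed by a sentinel. -/
structure HasDigits (I : SMInstance) (k : ℕ) (s : State) : Prop where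
  digit : ∀ i < I.forbidden.length, s.arr aDigit i = I.digit k i
  sentinel : s.arr aDigit I.forbidden.length = I.numEdges + 1

theorem edgeAt_zero : I.edgeAt 0 = none := if_pos rfl

theorem Loaded.edgeAt {s : State} (hL : I.Loaded s) {d : ℕ} (h0 : d ≠ 0) (hd : d ≤ I.numEdges) :
    ∃ e, I.edgeAt d = some e ∧ s.arr aEdge d = I.code e := by
  have hlt : d - 1 < I.edgeList.length := by rw [length_edgeList]; omega
  refine ⟨I.edgeList[d - 1], by simp [SMInstance.edgeAt, h0, hlt], ?_⟩
  have := hL.edge (d - 1) (by simpa using hlt)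
  rw [show 1 + (d - 1) = d by omega] at this
  simpa using this

/-- A repeated digit is counted again, so the count only bounds the number of deleted edges from
above. This is harmless, as `exists_deleted_eq` supplies a sequence with the exact count for each
relevant set. -/
theorem halts_mark {B : ℕ} (hB : I.Fits B) {s : State} (hL : I.Loaded s) {k : ℕ}
    (hk : I.HasDigits k s) (hD : Marked (I := I) ∅ s) :
    Halts B mark s (I.numEdges * 37 + 10) fun s' => Marked (I.deleted k) s' ∧
      s'.reg rCount = (I.deletedList k I.forbidden.length).length := by
  have hm := I.numEdges_le
  have hl := I.length_forbidden_le
  unfold Fits at hB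
  refine Halts.seq (T₁ := 2) (T₂ := I.numEdges * 37 + 5) (R := fun s' => s'.reg rCount = 0)
    (Halts.of_wp (by simp [wp, Expr.eval]) (by decide)) ?_ (by omega)
  intro s₁ h0 hF₁
  refine (Halts.for_loop (T₁ := 30) (N := I.forbidden.length) (fun i s' =>
      (∀ e, s'.arr aDel (I.code e) = if e ∈ I.deletedList k i then 1 else 0) ∧
      s'.reg rCount = (I.deletedList k i).length ∧ (I.deletedList k i).length ≤ i)
      (by rw [hF₁.reg _ rfl, hL.forb]) (by omega) (by norm_num) rfl rfl ?_
      (fun k s v h => by simpa using h) ?_ ?_).mono le_rfl ?_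
  · refine ⟨fun e => ?_, by simp [deletedList_zero, h0], by simp [deletedList_zero]⟩
    rw [hF₁.arr _ rfl, hD e]
    simp [deletedList_zero]
  · rintro i hi s' hF hx ⟨h1, h2, h3⟩
    have hdig : s'.arr aDigit i = I.digit k i := by
      rw [hF.arr _ rfl, hF₁.arr _ rfl, hk.digit i hi]
    refine Halts.of_wp ?_ (by decide)
    by_cases hz : I.digit k i = 0
    · simp only [wp, Expr.eval, Test.Holds, hx, hdig, hz]
      refine ⟨fun _ => ?_, fun h => absurd trivial h⟩
      rw [deletedList_succ, hz, edgeAt_zero]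
      exact ⟨by simpa using h1, by simpa using h2, by simpa using Nat.le_succ_of_le h3⟩
    · obtain ⟨e, he, hc⟩ := hL.edgeAt hz (I.digit_le k i)
      have hc' : s'.arr aEdge (I.digit k i) = I.code e := by
        rw [hF.arr _ rfl, hF₁.arr _ rfl, hc]
      have hlt := I.code_lt e
      simp [wp, Expr.eval, Test.Holds, hx, hdig, hz, hc', h2, deletedList_succ, he,
        Function.update_apply, I.code_injective.eq_iff]
      refine ⟨by omega, by omega, by omega, fun u w => ?_, by omega⟩
      by_cases hu : (u, w) = e
      · simp [hu]
      · simp [hu, h1]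
  · omega
  · rintro s' ⟨h1, h2, -⟩ -
    exact ⟨fun e => by simpa [deleted] using h1 e, h2⟩

/-- Only the cells named by the digits are cleared. A repeated digit clears its cell again, so the
invariant must override the original mark rather than count removals. -/
theorem halts_unmark {B : ℕ} (hB : I.Fits B) {s : State} (hL : I.Loaded s) {k : ℕ}
    (hk : I.HasDigits k s) (hD : Marked (I.deleted k) s) :
    Halts B unmark s (I.numEdges * 37 + 10) (Marked (I := I) ∅) := by
  have hm := I.numEdges_le
  have hl := I.length_forbidden_le
  unfold Fits at hB
  refine (Halts.for_loop (T₁ := 30) (N := I.forbidden.length) (fun i s' =>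
      ∀ e, s'.arr aDel (I.code e) =
        if e ∈ I.deletedList k i then 0 else if e ∈ I.deleted k then 1 else 0)
      hL.forb (by omega) (by norm_num) rfl rfl ?_
      (fun k s v h => by simpa using h) ?_ ?_).mono le_rfl ?_
  · intro e
    rw [hD e]
    simp [deletedList_zero]
  · rintro i hi s' hF hx h1
    have hdig : s'.arr aDigit i = I.digit k i := by
      rw [hF.arr _ rfl, hk.digit i hi]
    refine Halts.of_wp ?_ (by decide)
    by_cases hz : I.digit k i = 0
    · simp only [wp, Expr.eval, Test.Holds, hx, hdig, hz]
      refine ⟨fun _ => ?_, fun h => absurd trivial h⟩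
      rw [deletedList_succ, hz, edgeAt_zero]
      simpa using h1
    · obtain ⟨e, he, hc⟩ := hL.edgeAt hz (I.digit_le k i)
      have hc' : s'.arr aEdge (I.digit k i) = I.code e := by
        rw [hF.arr _ rfl, hc]
      have hlt := I.code_lt e
      simp [wp, Expr.eval, Test.Holds, hx, hdig, hz, hc', deletedList_succ, he,
        Function.update_apply, I.code_injective.eq_iff]
      refine ⟨by omega, fun u w => ?_⟩
      by_cases hu : (u, w) = e
      · simp [hu]
      · simp [hu, h1]
  · omega
  · intro s' h1 _ e
    rw [h1 e]
    simp [deleted]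

theorem halts_nextDigits {B : ℕ} (hB : I.Fits B) {s : State} (hL : I.Loaded s) {k : ℕ}
    (hk : I.HasDigits k s) (hkN : k < (I.numEdges + 1) ^ I.forbidden.length)
    (hdone : s.reg rDone = 0) :
    Halts B nextDigits s (I.numEdges * 20 + 40) fun s' =>
      (s'.reg rDone = 0 ∧ k + 1 < (I.numEdges + 1) ^ I.forbidden.length ∧
        I.HasDigits (k + 1) s') ∨
      (s'.reg rDone = 1 ∧ k + 1 = (I.numEdges + 1) ^ I.forbidden.length) := by
  have hm := I.numEdges_le
  have hl := I.length_forbidden_le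
  have hb : 0 < I.numEdges + 1 := Nat.succ_pos _
  unfold Fits at hB
  refine Halts.seq (T₁ := 2) (T₂ := I.numEdges * 20 + 38) (R := fun s' => s'.reg rInner = 0)
    (Halts.of_wp (by simp [wp, Expr.eval]) (by decide)) ?_ (by omega)
  intro s₁ h0 hF₁
  refine Halts.seq (T₁ := I.numEdges * 16 + 4) (T₂ := 30) (R := fun s' =>
    s'.reg rInner ≤ I.forbidden.length ∧ (∀ a < s'.reg rInner, I.digit k a + 1 = I.numEdges + 1) ∧
    (∀ a < s'.reg rInner, s'.arr aDigit a = 0) ∧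
    (∀ a, s'.reg rInner ≤ a → a < I.forbidden.length → s'.arr aDigit a = I.digit k a) ∧
    s'.arr aDigit I.forbidden.length = I.numEdges + 1 ∧
    s'.arr aDigit (s'.reg rInner) ≠ I.numEdges) ?_ ?_ (by omega)
  · refine (Halts.loop (T₁ := 12) (b := .eq (.get aDigit (.reg rInner)) (.reg rEdges))
      (fun r s' => s'.reg rInner + r = I.forbidden.length ∧
        (∀ a < s'.reg rInner, I.digit k a + 1 = I.numEdges + 1) ∧
        (∀ a < s'.reg rInner, s'.arr aDigit a = 0) ∧
        (∀ a, s'.reg rInner ≤ a → a < I.forbidden.length → s'.arr aDigit a = I.digit k a) ∧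
        s'.arr aDigit I.forbidden.length = I.numEdges + 1)
      (k := I.forbidden.length) ?_ ?_ ?_).mono le_rfl ?_
    · simp only [h0, hF₁.arr aDigit rfl]
      exact ⟨by omega, by simp, by simp, fun a _ => hk.digit a, hk.sentinel⟩
    · rintro r s' hF ⟨h1, h2, h3, h4, h5⟩ hb
      have hed : s'.reg rEdges = I.numEdges := by rw [hF.reg _ rfl, hF₁.reg _ rfl, hL.edges]
      simp only [Test.Holds, Expr.eval, hed] at hb
      -- At position `L` the sentinel `m + 1` differs from `m`, so the carry loop cannot continue
      -- there.
      have hr : r ≠ 0 := by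
        rintro rfl
        rw [Nat.add_zero] at h1
        rw [h1, h5] at hb
        omega
      have hdig := h4 _ le_rfl (by omega)
      refine Halts.of_wp ?_ (by decide)
      simp [wp, Expr.eval, Function.update_apply]
      refine ⟨by omega, by omega, r - 1, by omega, by omega, fun a ha => ?_, fun a ha hne => ?_,
        fun a ha ha' => ?_, ?_⟩
      · rcases Nat.lt_or_eq_of_le ha with ha | rfl
        · have := h2 a ha
          omega
        · omega
      · exact h3 a (by omega)
      · rw [if_neg (by omega), h4 a (by omega) ha']
      · rw [if_neg (by omega), h5]
    · simp only [Test.cost, Expr.cost]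
      omega
    · rintro s' ⟨⟨r, h1, h2, h3, h4, h5⟩, h6⟩ hF
      have hed : s'.reg rEdges = I.numEdges := by rw [hF.reg _ rfl, hF₁.reg _ rfl, hL.edges]
      simp only [Test.Holds, Expr.eval, hed] at h6
      exact ⟨by omega, h2, h3, h4, h5, h6⟩
  rintro s₂ ⟨h1, h2, h3, h4, h5, h6⟩ hF₂
  have hfo : s₂.reg rForb = I.forbidden.length := by rw [hF₂.reg _ rfl, hF₁.reg _ rfl, hL.forb]
  have hdo : s₂.reg rDone = 0 := by rw [hF₂.reg _ rfl, hF₁.reg _ rfl, hdone]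
  obtain ⟨i, hi⟩ : ∃ i, s₂.reg rInner = i := ⟨_, rfl⟩
  rw [hi] at h1 h2 h3 h4 h6
  refine Halts.of_wp ?_ (by decide)
  -- Either the carry stops at a proper digit, which is increased, or all digits were maximal and
  -- `k` was the last number.
  rcases Nat.lt_or_eq_of_le h1 with hlt | rfl
  · have hd := h4 i le_rfl hlt
    have hdl := I.digit_le k i
    have hd2 : I.digit k i + 1 < I.numEdges + 1 := by omega
    simp only [wp, Expr.eval, Test.Holds, hi, hfo]
    refine ⟨fun _ => ⟨by omega, by omega, .inl ⟨hdo, ?_, ⟨fun j hj => ?_, ?_⟩⟩⟩,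
      fun h => absurd hlt h⟩
    · exact Nat.succ_lt_pow_of_digit hb h2 hd2 hlt hkN
    · simp only [State.setArr_arr, if_true, Function.update_apply]
      rcases lt_trichotomy j i with hji | rfl | hji
      · rw [if_neg hji.ne, h3 j hji]
        exact (Nat.succ_digit_of_lt hb h2 hji).symm
      · rw [if_pos rfl, hd]
        exact (Nat.succ_digit_self hb h2 hd2).symm
      · rw [if_neg hji.ne', h4 j hji.le hj]
        exact (Nat.succ_digit_of_gt hb h2 hd2 hji).symm
    · simp only [State.setArr_arr, if_true, Function.update_apply]
      rw [if_neg hlt.ne', h5]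
  · simp only [wp, Expr.eval, Test.Holds, hi, hfo]
    refine ⟨fun h => absurd h (lt_irrefl _), fun _ => ⟨by omega, .inr ⟨by simp, ?_⟩⟩⟩
    have := Nat.mod_pow_add_one_of_digits (b := I.numEdges + 1) h2
    rwa [Nat.mod_eq_of_lt hkN] at this

/-- The best matching for the first `k` sequences of digits has been stored. -/
structure Found (I : SMInstance) (k : ℕ) (s : State) : Prop where
  le : s.reg rBest ≤ I.forbidden.length + 1
  best : ∀ j < k, ((∃ M, I.StableWithout (I.deleted j) M) ∨ I.forbiddenSet ⊆ I.deleted j) →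
    s.reg rBest ≤ (I.deletedList j I.forbidden.length).length
  stored : s.reg rBest ≤ I.forbidden.length →
    ∃ M, I.Outputs s M ∧ I.Feasible M ∧ (I.bp M).card ≤ s.reg rBest

theorem Found.congr {k : ℕ} {s s' : State} (h : I.Found k s) (hr : s'.reg rBest = s.reg rBest)
    (ha : s'.arr aOut = s.arr aOut) : I.Found k s' := by
  refine ⟨by rw [hr]; exact h.le, by rw [hr]; exact h.best, ?_⟩
  rw [hr]
  intro hb
  obtain ⟨M, h1, h2⟩ := h.stored hb
  exact ⟨M, by unfold Outputs; rw [ha]; exact h1, h2⟩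

theorem Found.succ {k : ℕ} {s : State} (h : I.Found k s)
    (hk : (∃ M, I.StableWithout (I.deleted k) M) ∨ I.forbiddenSet ⊆ I.deleted k →
      s.reg rBest ≤ (I.deletedList k I.forbidden.length).length) : I.Found (k + 1) s := by
  refine ⟨h.le, fun j hj => ?_, h.stored⟩
  rcases Nat.lt_succ_iff_lt_or_eq.1 hj with hlt | rfl
  · exact h.best j hlt
  · exact hk

/-- The steps which suffice for one sequence of digits, up to a constant factor. -/
def size (I : SMInstance) : ℕ := I.men * I.women + I.men + I.women + 1

theorem halts_keepBest {B : ℕ} (hB : I.Fits B) {s : State} (hL : I.Loaded s) {k : ℕ}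
    (hf : I.Found k s) (hc : s.reg rCount = (I.deletedList k I.forbidden.length).length)
    (hda : (s.reg rOk = 1 ∧ ∃ g : I.DAState, I.StableWithout (I.deleted k) g.matching ∧ Rep g s) ∨
      (s.reg rOk = 0 ∧ (∀ M, ¬ I.StableWithout (I.deleted k) M) ∧
        ¬ I.forbiddenSet ⊆ I.deleted k)) :
    Halts B keepBest s ((I.men + I.women) * 27 + 40) (I.Found (k + 1)) := by
  have hm := I.numEdges_le
  have hl := I.length_forbidden_le
  have hle := hf.le
  refine Halts.branch (T₁ := (I.men + I.women) * 27 + 30) (fun hb => ?_) (fun hb => ?_)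
    (by simp only [Test.cost, Expr.cost]; omega)
  · simp only [Test.Holds, Expr.eval] at hb
    rcases hda with ⟨-, g, hst, hg⟩ | ⟨h, -⟩
    swap
    · omega
    refine Halts.branch (T₁ := (I.men + I.women) * 27 + 20) (fun hb => ?_) (fun hb => ?_)
      (by simp only [Test.cost, Expr.cost]; omega)
    · simp only [Test.Holds, Expr.eval] at hb
      refine Halts.seq (T₁ := 10) (R := fun s' => s'.reg rBest = s.reg rCount)
        (Halts.of_wp ?_ (by decide)) (fun s₁ h1 hF₁ => ?_)
        (show 10 + ((I.men + I.women) * 27 + 10) ≤ _ by omega)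
      · unfold Fits at hB
        simp [wp, Expr.eval]
        omega
      have hL₁ : I.Loaded s₁ := hL.congr
        (fun y hy => hF₁.reg y (by simp [Prog.writesReg]; omega))
        (fun y _ _ => hF₁.arr y (by simp [Prog.writesArr]))
      have hg₁ : Rep g s₁ := by
        refine ⟨?_, ?_, ?_, ?_, ?_⟩
        · rw [hF₁.arr _ rfl]; exact hg.ptr
        · rw [hF₁.arr _ rfl]; exact hg.cur
        · rw [hF₁.arr _ rfl]; exact hg.best
        · rw [hF₁.reg _ rfl]; exact hg.top
        · rw [hF₁.arr _ rfl]; exact hg.stack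
      refine (halts_store hB hL₁ hg₁ hst.feasible.1).mono le_rfl ?_
      intro s₂ hout hF₂
      have hbest : s₂.reg rBest = s.reg rCount := by rw [hF₂.reg _ rfl, h1]
      refine ⟨by omega, fun j hj h => ?_, fun _ => ⟨_, hout, hst.feasible, ?_⟩⟩
      · rcases Nat.lt_succ_iff_lt_or_eq.1 hj with hlt | rfl
        · have := hf.best j hlt h
          omega
        · omega
      · rw [hbest, hc]
        -- The stored count bounds the size of the deleted set, which bounds the number of blocking
        -- edges.
        exact hst.card_bp_le.trans (List.toFinset_card_le _)
    · simp only [Test.Holds, Expr.eval, not_lt] at hb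
      exact Halts.of_wp (show wp B .skip (I.Found (k + 1)) s from hf.succ fun _ => by omega)
        (by simp only [Prog.maxCost]; omega)
  · simp only [Test.Holds, Expr.eval] at hb
    rcases hda with ⟨h, -⟩ | ⟨-, h1, h2⟩
    · exact absurd h hb
    · exact Halts.of_wp (show wp B .skip (I.Found (k + 1)) s from
        hf.succ fun h => (h.elim (fun ⟨M, hM⟩ => h1 M hM) h2).elim)
        (by simp only [Prog.maxCost]; omega)

/-- Marking, unmarking and incrementing take `O(m)` steps since `L ≤ m`, and everything is `O(size)`
since `m ≤ men * women`. Unmarking restores the empty mark set for the next round. -/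
theorem halts_tryDigits {B : ℕ} (hB : I.Fits B) {s : State} (hL : I.Loaded s) {k : ℕ}
    (hk : I.HasDigits k s) (hkN : k < (I.numEdges + 1) ^ I.forbidden.length)
    (hdone : s.reg rDone = 0) (hD : Marked (I := I) ∅ s) (hf : I.Found k s) :
    Halts B tryDigits s (1000 * I.size) fun s' => I.Loaded s' ∧ Marked (I := I) ∅ s' ∧
      I.Found (k + 1) s' ∧
      ((s'.reg rDone = 0 ∧ k + 1 < (I.numEdges + 1) ^ I.forbidden.length ∧
        I.HasDigits (k + 1) s') ∨
      (s'.reg rDone = 1 ∧ k + 1 = (I.numEdges + 1) ^ I.forbidden.length)) := by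
  have hm := I.numEdges_le
  refine Halts.seq (halts_mark hB hL hk hD) (T₂ := 900 * I.size) ?_ (by unfold size; omega)
  rintro s₁ ⟨hD₁, hc₁⟩ hF₁
  have hL₁ : I.Loaded s₁ := hL.congr
    (fun y hy => hF₁.reg y (by simp [mark, forLoop, Prog.writesReg]; omega))
    (fun y hy _ => hF₁.arr y (by simp [mark, forLoop, Prog.writesArr]; omega))
  refine Halts.seq (halts_runDA hB hL₁ hD₁) (T₂ := 300 * I.size) ?_ (by unfold size; omega)
  intro s₂ hda hF₂
  have hL₂ : I.Loaded s₂ := hL₁.congr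
    (fun y hy => hF₂.reg y (by
      simp [runDA, initDA, stepDA, accept, checkDA, forLoop, Prog.writesReg]; omega))
    (fun y hy _ => hF₂.arr y (by
      simp [runDA, initDA, stepDA, accept, checkDA, forLoop, Prog.writesArr]; omega))
  have hf₂ : I.Found k s₂ := hf.congr (by rw [hF₂.reg _ rfl, hF₁.reg _ rfl])
    (by rw [hF₂.arr _ rfl, hF₁.arr _ rfl])
  refine Halts.seq (halts_keepBest hB hL₂ hf₂ (by rw [hF₂.reg _ rfl, hc₁]) hda)
    (T₂ := 200 * I.size) ?_ (by unfold size; omega)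
  intro s₃ hf₃ hF₃
  have hL₃ : I.Loaded s₃ := hL₂.congr
    (fun y hy => hF₃.reg y (by simp [keepBest, store, forLoop, Prog.writesReg]; omega))
    (fun y hy hy' => hF₃.arr y (by simp [keepBest, store, forLoop, Prog.writesArr]; omega))
  have hdig₃ : s₃.arr aDigit = s.arr aDigit := by
    rw [hF₃.arr _ rfl, hF₂.arr _ rfl, hF₁.arr _ rfl]
  have hk₃ : I.HasDigits k s₃ := ⟨by rw [hdig₃]; exact hk.digit, by rw [hdig₃]; exact hk.sentinel⟩
  have hD₃ : Marked (I.deleted k) s₃ := by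
    unfold Marked
    rw [hF₃.arr _ rfl, hF₂.arr _ rfl]
    exact hD₁
  refine Halts.seq (halts_unmark hB hL₃ hk₃ hD₃) (T₂ := 100 * I.size) ?_ (by unfold size; omega)
  intro s₄ hD₄ hF₄
  have hL₄ : I.Loaded s₄ := hL₃.congr
    (fun y hy => hF₄.reg y (by simp [unmark, forLoop, Prog.writesReg]; omega))
    (fun y hy _ => hF₄.arr y (by simp [unmark, forLoop, Prog.writesArr]; omega))
  have hdig₄ : s₄.arr aDigit = s.arr aDigit := by rw [hF₄.arr _ rfl, hdig₃]
  have hk₄ : I.HasDigits k s₄ := ⟨by rw [hdig₄]; exact hk.digit, by rw [hdig₄]; exact hk.sentinel⟩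
  refine (halts_nextDigits hB hL₄ hk₄ hkN ?_).mono (by unfold size; omega) ?_
  · rw [hF₄.reg _ rfl, hF₃.reg _ rfl, hF₂.reg _ rfl, hF₁.reg _ rfl, hdone]
  intro s₅ h hF₅
  refine ⟨hL₄.congr
    (fun y hy => hF₅.reg y (by simp [nextDigits, Prog.writesReg]; omega))
    (fun y hy _ => hF₅.arr y (by simp [nextDigits, Prog.writesArr]; omega)), ?_, ?_, h⟩
  · unfold Marked
    rw [hF₅.arr _ rfl]
    exact hD₄
  · exact hf₃.congr (by rw [hF₅.reg _ rfl, hF₄.reg _ rfl]) (by rw [hF₅.arr _ rfl, hF₄.arr _ rfl])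

/-- When all sequences of digits have been dealt with, the stored matching is optimal. -/
theorem Found.exists_solution {s : State}
    (h : I.Found ((I.numEdges + 1) ^ I.forbidden.length) s) :
    ∃ M, I.Outputs s M ∧ I.IsSolution M := by
  -- The set `P` itself occurs in the enumeration, and deleting it succeeds.
  have hL : s.reg rBest ≤ I.forbidden.length := by
    obtain ⟨k, hk, h1, h2⟩ := I.exists_deleted_eq forbiddenSet_subset_edges card_forbiddenSet.le
    have := h.best k hk (.inr h1.ge)
    rwa [h2, card_forbiddenSet] at this
  obtain ⟨M, h1, h2, h3⟩ := h.stored hL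
  refine ⟨M, h1, h2, fun M' hM' => h3.trans ?_⟩
  -- A competitor with at most `L` blocking edges is found through the deleted set `bp M'`; any
  -- other has more than `L` and loses by `hL`.
  by_cases hc : (I.bp M').card ≤ I.forbidden.length
  · obtain ⟨k, hk, h4, h5⟩ := I.exists_deleted_eq (bp_subset_edges M') hc
    rw [← h5]
    exact h.best k hk (.inl ⟨M', h4 ▸ hM'.stableWithout_bp⟩)
  · omega

theorem halts_solve {B : ℕ} (hB : I.Fits B) :
    Halts B solve (initial I.encode)
      (200 * I.size + ((I.numEdges + 1) ^ I.forbidden.length * (1000 * I.size + 3) + 3))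
      fun s => ∃ M, I.Outputs s M ∧ I.IsSolution M := by
  have hm := I.numEdges_le
  have hpos : 0 < (I.numEdges + 1) ^ I.forbidden.length := pow_pos (Nat.succ_pos _) _
  refine Halts.seq (halts_load hB) ?_ (Nat.add_le_add_right (?_ : _ ≤ 200 * I.size) _)
  swap
  · unfold size
    rw [mul_add, mul_add, ← mul_assoc, ← mul_assoc, mul_comm I.women I.men]
    omega
  rintro s₁ ⟨hL, hbest, hsent, hdig⟩ hF₁
  refine (Halts.loop (T₁ := 1000 * I.size) (b := .eq (.reg rDone) (.lit 0))
    (fun r s => ∃ k, k + r = (I.numEdges + 1) ^ I.forbidden.length ∧ I.Loaded s ∧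
      Marked (I := I) ∅ s ∧ I.Found k s ∧
      ((s.reg rDone = 0 ∧ k < (I.numEdges + 1) ^ I.forbidden.length ∧ I.HasDigits k s) ∨
      (s.reg rDone = 1 ∧ k = (I.numEdges + 1) ^ I.forbidden.length)))
    -- Initially the best count is `L + 1`, so the claim about a stored matching is vacuous.
    ⟨0, by omega, hL, ?_, ⟨hbest.le, by simp, fun h => by omega⟩,
      .inl ⟨by rw [hF₁.reg _ rfl]; rfl, hpos, ⟨fun i hi => ?_, hsent⟩⟩⟩ ?_ le_rfl).mono le_rfl ?_
  · intro e
    rw [hF₁.arr _ rfl]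
    simp [initial]
  · simp [hdig i hi, digit]
  · rintro r s' hF ⟨k, hkr, h1, h2, h3, ⟨h4, h5, h6⟩ | ⟨h4, h5⟩⟩ hb
    · refine (halts_tryDigits hB h1 h6 h5 h4 h2 h3).mono le_rfl ?_
      rintro s'' ⟨h7, h8, h9, h10⟩ -
      exact ⟨r - 1, by omega, k + 1, by omega, h7, h8, h9, h10⟩
    · simp [Test.Holds, Expr.eval, h4] at hb
  · rintro s' ⟨⟨r, k, hkr, h1, h2, h3, ⟨h4, -⟩ | ⟨h4, rfl⟩⟩, hb⟩ -
    · simp [Test.Holds, Expr.eval, h4] at hb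
    · exact h3.exists_solution

/-! ### The size of the input and of the words -/

theorem length_flatMap_manWords :
    ((List.finRange I.men).flatMap I.manWords).length = I.numEdges + I.men := by
  rw [← sum_length_manList, Fin.sum_univ_def, List.length_flatMap]
  simp [manWords, List.sum_map_add]

theorem length_flatMap_womanWords_le :
    ((List.finRange I.women).flatMap I.womanWords).length ≤ I.women * (I.men + 1) := by
  rw [List.length_flatMap]
  have := List.sum_le_card_nsmul ((List.finRange I.women).map fun w => (I.womanWords w).length)
    (I.men + 1) (by simpa [womanWords] using fun w => I.length_womanList_le w)
  simpa using this

theorem le_length_flatMap_womanWords :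
    I.women ≤ ((List.finRange I.women).flatMap I.womanWords).length := by
  rw [List.length_flatMap]
  have := List.card_nsmul_le_sum ((List.finRange I.women).map fun w => (I.womanWords w).length)
    1 (by simp [womanWords])
  simpa using this

theorem length_encode : I.encode.length = I.numEdges + I.men +
    ((List.finRange I.women).flatMap I.womanWords).length + 2 * I.forbidden.length + 3 := by
  have : (I.forbidden.flatMap fun e => [e.1.val, e.2.val]).length = 2 * I.forbidden.length := by
    simp [List.length_flatMap, mul_comm]
  rw [encode_eq]
  simp only [List.length_cons, List.length_append, length_flatMap_manWords, this]
  omega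

theorem mul_le_numVertices_sq : I.men * I.women ≤ I.numVertices ^ 2 := by
  unfold numVertices
  nlinarith

/-- Input length and table size are below `8 * (n + 2) ^ 2`, and `8 ≤ (n + 2) ^ 3` absorbs the
factor. The base `n + 2` keeps this true for tiny graphs. -/
theorem fits_pow {C : ℕ} (hC : 5 ≤ C) : I.Fits ((I.numVertices + 2) ^ C) := by
  have h1 := I.length_encode
  have h2 := I.length_flatMap_womanWords_le
  have h3 := I.numEdges_le
  have h4 := I.length_forbidden_le
  have h5 := I.mul_le_numVertices_sq
  have h6 : (I.numVertices + 2) ^ 5 ≤ (I.numVertices + 2) ^ C :=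
    Nat.pow_le_pow_right (by omega) hC
  have h7 : 8 * (I.numVertices + 2) ^ 2 ≤ (I.numVertices + 2) ^ 5 := by
    rw [show (I.numVertices + 2) ^ 5 = (I.numVertices + 2) ^ 3 * (I.numVertices + 2) ^ 2 by ring]
    exact Nat.mul_le_mul_right _ (Nat.pow_le_pow_left (show 2 ≤ I.numVertices + 2 by omega) 3)
  have h8 : 8 * (I.numVertices + 2) ^ 2 = 8 * I.numVertices ^ 2 + 32 * I.numVertices + 32 := by ring
  have h9 : I.numVertices = I.men + I.women := rfl
  rw [mul_add, mul_comm I.women I.men] at h2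
  unfold Fits
  omega

/-- With `x = m ^ L`, the total is at most `(3009 + 200) * (size * x) + 3`, and `size * x ≤ 3 * (n ^
2 * x + 1)`; hence 13000 is ample. -/
theorem steps_le : 200 * I.size +
    ((I.numEdges + 1) ^ I.forbidden.length * (1000 * I.size + 3) + 3) ≤
    13000 * (I.numVertices ^ 2 * I.numEdges ^ I.forbidden.length + 1) := by
  have h1 := Nat.succ_pow_le_three_mul I.length_forbidden_le
  have h2 := I.mul_le_numVertices_sq
  have h3 : I.size ≤ 2 * I.numVertices ^ 2 + 1 := by
    have : I.numVertices ≤ I.numVertices ^ 2 := Nat.le_self_pow (by norm_num) _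
    have h9 : I.numVertices = I.men + I.women := rfl
    unfold size
    omega
  have h4 : 1 ≤ I.size := by unfold size; omega
  have h5 : 1 ≤ I.numEdges ^ I.forbidden.length := by
    rcases Nat.eq_zero_or_pos I.numEdges with h | h
    · have := I.length_forbidden_le
      rw [show I.forbidden.length = 0 by omega, pow_zero]
    · exact Nat.one_le_pow _ _ h
  obtain ⟨x, hx⟩ : ∃ x, x = I.numEdges ^ I.forbidden.length := ⟨_, rfl⟩
  have h6 : (2 * I.numVertices ^ 2 + 1) * x ≤ 3 * (I.numVertices ^ 2 * x + 1) := by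
    -- Without vertices also `m = L = 0` and `x = 0 ^ 0 = 1`; the summand 1 in the bound covers this
    -- case.
    rcases Nat.eq_zero_or_pos I.numVertices with h | h
    · have := I.length_forbidden_le
      have h7 := I.numEdges_le
      rw [h] at h2
      have : I.forbidden.length = 0 := by omega
      rw [hx, this, h]
      norm_num
    · have : 1 * x ≤ I.numVertices ^ 2 * x := Nat.mul_le_mul_right _ (Nat.one_le_pow _ _ h)
      nlinarith
  rw [← hx] at h1 h5 ⊢
  have h8 : (I.numEdges + 1) ^ I.forbidden.length * (1000 * I.size + 3) ≤
      3 * x * (1003 * I.size) := Nat.mul_le_mul h1 (by omega)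
  have h9 : I.size * x ≤ (2 * I.numVertices ^ 2 + 1) * x := Nat.mul_le_mul_right _ h3
  have h10 : I.size * 1 ≤ I.size * x := Nat.mul_le_mul_left _ h5
  have h11 : 3 * x * (1003 * I.size) = 3009 * (I.size * x) := by ring
  omega

theorem SolvedBy.mono {p : Prog} {B T T' : ℕ} (h : I.SolvedBy p B T) (hT : T ≤ T') :
    I.SolvedBy p B T' := by
  obtain ⟨t, s, M, h1, h2, h3⟩ := h
  exact ⟨t, s, M, h1, h2.trans hT, h3⟩

theorem solvedBy_solve (I : SMInstance) : I.SolvedBy solve ((I.numVertices + 2) ^ 13000)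
    (13000 * (I.numVertices ^ 2 * I.numEdges ^ I.forbiddenSet.card + 1)) := by
  obtain ⟨t, s, h1, h2, M, h3⟩ := halts_solve (I.fits_pow (C := 13000) (by norm_num))
  rw [card_forbiddenSet]
  exact ⟨t, s, M, h1, h2.trans I.steps_le, h3⟩

end SMInstance

theorem mainTheorem11 :
    ∃ (p : RAM.Prog) (C : ℕ),
      (∀ I : SMInstance,
        I.SolvedBy p ((I.numVertices + 2) ^ C)
          (C * (I.numVertices ^ 2 * I.numEdges ^ I.forbiddenSet.card + 1))) ∧
      (∀ L : ℕ, ∃ q : Polynomial ℕ, ∀ I : SMInstance, I.forbiddenSet.card = L →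
        I.SolvedBy p ((I.numVertices + 2) ^ C) (q.eval I.encode.length)) := by
  refine ⟨RAM.solve, 13000, fun I => I.solvedBy_solve, fun L =>
    -- Both `n` and `m` are at most the input length, so the first bound is monotonically replaced
    -- by this polynomial.
    ⟨Polynomial.C 13000 * (Polynomial.X ^ 2 * Polynomial.X ^ L + 1), fun I hI =>
      I.solvedBy_solve.mono ?_⟩⟩
  have h1 := I.length_encode
  have h2 := I.le_length_flatMap_womanWords
  have h3 : I.numVertices ≤ I.encode.length := by
    unfold SMInstance.numVertices
    omega
  have h4 : I.numEdges ≤ I.encode.length := by omega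
  simp only [hI, Polynomial.eval_mul, Polynomial.eval_C, Polynomial.eval_add, Polynomial.eval_pow,
    Polynomial.eval_X, Polynomial.eval_one]
  gcongr
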